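/- Let $C_0,C_1,C_2$ be circles of positive radius in the plane $\mathbb{R}^2=\mathbb{C}$ that are pairwise externally tangent. For circles $C,C'$ such that $C_0,C,C'$ are pairwise externally tangent, the three closed discs they bound divide the rest of the plane into two regions, exactly one of which is bounded; let $s(C,C')$, the successor, be the circle lying in the bounded region and tangent to all of $C_0,C,C'$. Let $\mathcal{C}$ be the smallest set of circles such that $C_1,C_2\in\mathcal{C}$ and $s(C,C')\in\mathcal{C}$ for all tangent $C,C'\in\mathcal{C}$; all circles of $\mathcal{C}$ are externally tangent to $C_0$. For $C\in\mathcal{C}$ with center $c$, put $v(C)=c-c_0$, where $c_0$ is the center of $C_0$, let $\ell^{1/2}(C)=\mathbb{R}\,v(C)^{1/2}$ be the real line spanned by a complex square root of $v(C)$, and let $\alpha(C)$ be the angle of $v(C)$ with the positive $x$-axis, where $\alpha(C_1)\in(-\pi,\pi]$ and $\alpha(C)-\alpha(C_1)\in(-\pi,\pi]$. Write $[\alpha(C_1),\alpha(C_2)]$ for the closed interval with end points $\alpha(C_1)$ and $\alpha(C_2)$, in whichever order; it contains $\alpha(C)$ for all $C\in\mathcal{C}$. An Apollonian curve associated to $(C_0,C_1,C_2)$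 is a continuous map $\gamma:[\alpha(C_1),\alpha(C_2)]\to\mathbb{R}^2$ such that \[\gamma(\alpha(C))-\gamma(\alpha(C'))\in\ell^{1/2}(s(C,C'))\qquad\text{for all tangent }C,C'\in\mathcal{C}.\] Theorem. For every ordered triple $(C_0,C_1,C_2)$ of pairwise externally tangent circles of positive radius there is a nonconstant Apollonian curve associated to it, and it is unique up to translation and scaling: if $\gamma,\gamma'$ are Apollonian curves associated to $(C_0,C_1,C_2)$ and $\gamma$ is not constant, then there are $a\in\mathbb{R}$ and $b\in\mathbb{R}^2$ with $\gamma'=a\gamma+b$. -/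

import Mathlib

open EuclideanGeometry

noncomputable section

namespace Apollonian

/-- A circle in the plane `ℝ² = ℂ`, given by its center and radius. Proper circles are those
with `0 < C.radius`. -/
abbrev PlaneCircle := Sphere ℂ

/-- The closed disc bounded by a circle. -/
def disc (C : PlaneCircle) : Set ℂ := Metric.closedBall C.center C.radius

/-- `S` is the successor of the externally tangent triple `(C₀, C, C')`: the circle that is
tangent to all three circles (necessarily externally) and lies in the bounded one of the regions
into which the three closed discs divide the plane. The open disc bounded by `S` is
connected and misses the three closed discs, so it lies in the connected component of its
center. -/
structure IsSuccessor (C₀ C C' S : PlaneCircle) : Prop where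
  radius_pos : 0 < S.radius
  tangent₀ : C₀.IsExtTangent S
  tangent₁ : C.IsExtTangent S
  tangent₂ : C'.IsExtTangent S
  bounded_region :
    Bornology.IsBounded (connectedComponentIn (disc C₀ ∪ disc C ∪ disc C')ᶜ S.center)

/-- The smallest family of circles containing `C₁` and `C₂` and containing, with any two tangent
circles `C`, `C'`, the successor of `(C₀, C, C')`. -/
inductive Family (C₀ C₁ C₂ : PlaneCircle) : PlaneCircle → Prop
  | left : Family C₀ C₁ C₂ C₁
  | right : Family C₀ C₁ C₂ C₂
  | succ {C C' S : PlaneCircle} : Family C₀ C₁ C₂ C → Family C₀ C₁ C₂ C' →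
      C.IsExtTangent C' → IsSuccessor C₀ C C' S → Family C₀ C₁ C₂ S

/-- The vector `v(C) = c - c₀` from the center of `C₀` to the center of `C`. -/
def v (C₀ C : PlaneCircle) : ℂ := C.center - C₀.center

/-- The angle `α(C)` of the vector `v(C)` with the positive `x`-axis. Angles are only defined
modulo `2π`; the values are chosen so that `α(C₁)` is the principal argument of `v(C₁)` and every
other angle is at signed distance in `(-π, π]` from it. -/
def angle (C₀ C₁ C : PlaneCircle) : ℝ :=
  Complex.arg (v C₀ C₁) + Complex.arg (v C₀ C / v C₀ C₁)

/-- The closed interval with end points `α(C₁)` and `α(C₂)`, in whichever order these lie on the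
real line. -/
def angleInterval (C₀ C₁ C₂ : PlaneCircle) : Set ℝ :=
  Set.uIcc (angle C₀ C₁ C₁) (angle C₀ C₁ C₂)

/-- The real line `ℝ v(C)^{1/2}` spanned by a complex square root of `v(C)`; the two square roots
span the same line. -/
def sqrtLine (C₀ C : PlaneCircle) : Set ℂ :=
  {z | ∃ w : ℂ, w ^ 2 = v C₀ C ∧ ∃ t : ℝ, z = t * w}

/-- `γ`, regarded as a function on the interval `[α(C₁), α(C₂)]`, is an Apollonian curve associated
to the triple `(C₀, C₁, C₂)`: it is continuous there, and for all tangent circles `C`, `C'` of the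
family the angles lie in the interval and `γ(α(C)) - γ(α(C'))` is on the square-root line of
the successor of `(C₀, C, C')`. -/
structure IsApollonianCurve (C₀ C₁ C₂ : PlaneCircle) (γ : ℝ → ℂ) : Prop where
  continuousOn : ContinuousOn γ (angleInterval C₀ C₁ C₂)
  chord : ∀ C C' : PlaneCircle, Family C₀ C₁ C₂ C → Family C₀ C₁ C₂ C' → C.IsExtTangent C' →
    angle C₀ C₁ C ∈ angleInterval C₀ C₁ C₂ ∧ angle C₀ C₁ C' ∈ angleInterval C₀ C₁ C₂ ∧
    ∃ S : PlaneCircle, IsSuccessor C₀ C C' S ∧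
      γ (angle C₀ C₁ C) - γ (angle C₀ C₁ C') ∈ sqrtLine C₀ S

/-- `γ` is not constant on the interval `[α(C₁), α(C₂)]`. -/
def Nonconstant (C₀ C₁ C₂ : PlaneCircle) (γ : ℝ → ℂ) : Prop :=
  ∃ s ∈ angleInterval C₀ C₁ C₂, ∃ t ∈ angleInterval C₀ C₁ C₂, γ s ≠ γ t

end Apollonian

end

/-! A circle of radius `r` tangent to `C₀` is encoded by a spinor `ψ`, unique up to sign, with `v(C)
= r ψ²` and `|ψ|² = 1 + r₀ / r`. Two such circles are tangent iff `det ψ φ = ±1`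
(`spinorCircle_isExtTangent_iff`), and if `dot ψ φ > 0` the successor has spinor `ψ + φ`
(`isSuccessor_iff`). So every circle of the family has a spinor `p ψ + q φ` with natural `p`, `q`,
tangency means `p q' - q p' = ±1`, and the chord between two tangent circles must be a real multiple
of the sum of their spinors. In the basis `ψ`, `φ` the problem no longer depends on the initial
circles.

Existence: place the end points at `(0, 0)` and `(1, 1)`. The value at the successor lies on lines
of directions `(2, 1)` and `(1, 2)`, hence is `(1/3, 2/3)`. Each half of the curve is then the image
of the whole under the change of basis `(ψ, φ) ↦ (ψ + φ, φ)` or `(ψ, ψ + φ)`, scaled by `1/3`. These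
equations define a contraction, whose fixed point is the curve (`exists_fareyCurve`,
`IsFareyCurve.chord`); transporting the parameter to the angle gives `γ`.

Uniqueness: a curve with equal values at both ends takes that value at every successor, hence at a
dense set of angles, hence everywhere (`const_of_eq`). Apply this to `γ' - a γ`, with `a` chosen to
equalize the end values. -/

noncomputable section

namespace Apollonian

/-! ### Spinors of circles tangent to `C₀` -/

/-- The determinant of two vectors of `ℝ² = ℂ`. -/
def det (z w : ℂ) : ℝ := z.re * w.im - z.im * w.re

/-- The scalar product of two vectors of `ℝ² = ℂ`. -/
def dot (z w : ℂ) : ℝ := z.re * w.re + z.im * w.im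

/-- The circle tangent to `C₀` with spinor `ψ`: the square of `ψ` is the vector `v(C)` divided by
the radius of `C`. -/
def spinorCircle (C₀ : PlaneCircle) (ψ : ℂ) : PlaneCircle where
  center := C₀.center + ((C₀.radius / (Complex.normSq ψ - 1) : ℝ) : ℂ) * ψ ^ 2
  radius := C₀.radius / (Complex.normSq ψ - 1)

lemma spinorCircle_neg (C₀ : PlaneCircle) (ψ : ℂ) : spinorCircle C₀ (-ψ) = spinorCircle C₀ ψ := by
  simp [spinorCircle]

lemma spinorCircle_radius_pos {C₀ : PlaneCircle} (h₀ : 0 < C₀.radius) {ψ : ℂ}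
    (hψ : 1 < Complex.normSq ψ) : 0 < (spinorCircle C₀ ψ).radius :=
  div_pos h₀ (by linarith)

lemma v_spinorCircle (C₀ : PlaneCircle) (ψ : ℂ) :
    v C₀ (spinorCircle C₀ ψ) = ((spinorCircle C₀ ψ).radius : ℂ) * ψ ^ 2 := by
  simp [v, spinorCircle]

lemma radius_mul_normSq (C₀ : PlaneCircle) {ψ : ℂ} (hψ : 1 < Complex.normSq ψ) :
    (spinorCircle C₀ ψ).radius * Complex.normSq ψ =
      C₀.radius + (spinorCircle C₀ ψ).radius := by
  have : Complex.normSq ψ - 1 ≠ 0 := by linarith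
  simp only [spinorCircle]
  field_simp
  ring

lemma isExtTangent_iff_normSq {C C' : PlaneCircle} (h : 0 < C.radius) (h' : 0 < C'.radius) :
    C.IsExtTangent C' ↔
      Complex.normSq (C.center - C'.center) = (C.radius + C'.radius) ^ 2 := by
  rw [Sphere.isExtTangent_iff_dist_center, Complex.normSq_eq_norm_sq, dist_eq_norm]
  constructor
  · rintro ⟨h1, -⟩
    rw [h1]
  · intro h1
    exact ⟨(sq_eq_sq₀ (norm_nonneg _) (by positivity)).1 h1, h.le, h'.le⟩

lemma isExtTangent_spinorCircle {C₀ : PlaneCircle} (h₀ : 0 < C₀.radius) {ψ : ℂ}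
    (hψ : 1 < Complex.normSq ψ) : C₀.IsExtTangent (spinorCircle C₀ ψ) := by
  rw [isExtTangent_iff_normSq h₀ (spinorCircle_radius_pos h₀ hψ), ← radius_mul_normSq C₀ hψ,
    ← Complex.normSq_neg, neg_sub]
  change Complex.normSq (v C₀ _) = _
  rw [v_spinorCircle, map_mul, map_pow, Complex.normSq_ofReal]
  ring

lemma exists_eq_spinorCircle {C₀ C : PlaneCircle} (h₀ : 0 < C₀.radius) (h : 0 < C.radius)
    (hC : C₀.IsExtTangent C) : ∃ ψ, 1 < Complex.normSq ψ ∧ C = spinorCircle C₀ ψ := by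
  obtain ⟨ψ, hψ⟩ := IsAlgClosed.exists_pow_nat_eq ((C.center - C₀.center) / C.radius)
    (n := 2) (by norm_num)
  have hn : Complex.normSq ψ = (C₀.radius + C.radius) / C.radius := by
    have h1 : Complex.normSq ψ ^ 2 = ((C₀.radius + C.radius) / C.radius) ^ 2 := by
      rw [isExtTangent_iff_normSq h₀ h, ← Complex.normSq_neg, neg_sub] at hC
      rw [← map_pow, hψ, Complex.normSq_div, hC, Complex.normSq_ofReal]
      field_simp
    exact (sq_eq_sq₀ (Complex.normSq_nonneg _) (by positivity)).1 h1
  have hr : C₀.radius / (Complex.normSq ψ - 1) = C.radius := by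
    have h1 : (C₀.radius + C.radius) / C.radius - 1 = C₀.radius / C.radius := by
      field_simp
      ring
    rw [hn, h1]
    field_simp
  refine ⟨ψ, ?_, ?_⟩
  · rw [hn, lt_div_iff₀ h]
    linarith
  · have hc : (C.radius : ℂ) ≠ 0 := by exact_mod_cast h.ne'
    ext1
    · simp only [spinorCircle, hr, hψ]
      field_simp
      ring
    · simp only [spinorCircle, hr]

lemma dot_sq_add_det_sq (ψ φ : ℂ) :
    dot ψ φ ^ 2 + det ψ φ ^ 2 = Complex.normSq ψ * Complex.normSq φ := by
  simp only [dot, det, Complex.normSq_apply]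
  ring

lemma spinorCircle_isExtTangent_iff {C₀ : PlaneCircle} (h₀ : 0 < C₀.radius) {ψ φ : ℂ}
    (hψ : 1 < Complex.normSq ψ) (hφ : 1 < Complex.normSq φ) :
    (spinorCircle C₀ ψ).IsExtTangent (spinorCircle C₀ φ) ↔ det ψ φ ^ 2 = 1 := by
  have h1 := spinorCircle_radius_pos h₀ hψ
  have h2 := spinorCircle_radius_pos h₀ hφ
  rw [isExtTangent_iff_normSq h1 h2]
  have e1 := radius_mul_normSq C₀ hψ
  have e2 := radius_mul_normSq C₀ hφ
  have e : (spinorCircle C₀ ψ).center - (spinorCircle C₀ φ).center =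
      v C₀ (spinorCircle C₀ ψ) - v C₀ (spinorCircle C₀ φ) := by simp [v]
  rw [e, v_spinorCircle, v_spinorCircle]
  set r := (spinorCircle C₀ ψ).radius
  set s := (spinorCircle C₀ φ).radius
  -- Since `r |ψ|² = r₀ + r` and `s |φ|² = r₀ + s`, the right side becomes `(r - s)² + 4 r s det²`,
  -- which equals `(r + s)²` exactly when `det² = 1`.
  have key : Complex.normSq ((r : ℂ) * ψ ^ 2 - s * φ ^ 2) =
      (r * Complex.normSq ψ - s * Complex.normSq φ) ^ 2 + 4 * (r * s) * det ψ φ ^ 2 := by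
    simp only [Complex.normSq_apply, det, pow_two, Complex.sub_re, Complex.sub_im,
      Complex.mul_re, Complex.mul_im, Complex.ofReal_re, Complex.ofReal_im]
    ring
  rw [key, e1, e2]
  have : r * s ≠ 0 := by positivity
  constructor
  · intro h
    apply mul_left_cancel₀ this
    linarith
  · intro h
    rw [h]
    ring

/-! ### Bounded and unbounded complementary regions -/

lemma segment_subset_disc_union {C C' : PlaneCircle} (h : C.IsExtTangent C') :
    segment ℝ C.center C'.center ⊆ disc C ∪ disc C' := by
  obtain ⟨h, h1, h2⟩ := Sphere.isExtTangent_iff_dist_center.1 h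
  intro z hz
  have hz' := dist_add_dist_of_mem_segment hz
  simp only [disc, Set.mem_union, Metric.mem_closedBall]
  rw [dist_comm z]
  by_contra! hc
  linarith

/-- The discs cover the edges of the triangle of centers, so a connected set that avoids them and
meets the open triangle cannot leave it. -/
lemma isBounded_connectedComponentIn_of_mem_triangle {C₀ C C' : PlaneCircle}
    (h1 : C₀.IsExtTangent C) (h2 : C₀.IsExtTangent C') (h3 : C.IsExtTangent C')
    (hd : det (v C₀ C) (v C₀ C') ≠ 0) {s : ℂ} (hs : s ∈ (disc C₀ ∪ disc C ∪ disc C')ᶜ)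
    {a b : ℝ} (ha : 0 < a) (hb : 0 < b) (hab : a + b < 1)
    (hsv : s - C₀.center = a * v C₀ C + b * v C₀ C') :
    Bornology.IsBounded (connectedComponentIn (disc C₀ ∪ disc C ∪ disc C')ᶜ s) := by
  -- Cramer coordinates with respect to `v C₀ C` and `v C₀ C'`, with origin at the center of `C₀`.
  let x : ℂ → ℝ := fun z ↦ det (z - C₀.center) (v C₀ C') / det (v C₀ C) (v C₀ C')
  let y : ℂ → ℝ := fun z ↦ det (v C₀ C) (z - C₀.center) / det (v C₀ C) (v C₀ C')
  have hx : Continuous x := by unfold x det; fun_prop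
  have hy : Continuous y := by unfold y det; fun_prop
  have hrep (z : ℂ) : z = C₀.center + x z * v C₀ C + y z * v C₀ C' := by
    apply Complex.ext
    · simp only [x, y, Complex.add_re, Complex.re_ofReal_mul]
      field_simp
      simp only [det, Complex.sub_re, Complex.sub_im]
      ring
    · simp only [x, y, Complex.add_im, Complex.im_ofReal_mul]
      field_simp
      simp only [det, Complex.sub_re, Complex.sub_im]
      ring
  have hxs : x s = a := by
    simp only [x]
    rw [div_eq_iff hd, hsv]
    simp only [det, Complex.add_re, Complex.re_ofReal_mul, Complex.add_im, Complex.im_ofReal_mul]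
    ring
  have hys : y s = b := by
    simp only [y]
    rw [div_eq_iff hd, hsv]
    simp only [det, Complex.add_re, Complex.re_ofReal_mul, Complex.add_im, Complex.im_ofReal_mul]
    ring
  let U : Set ℂ := {z | 0 < x z} ∩ {z | 0 < y z} ∩ {z | x z + y z < 1}
  let V : Set ℂ := {z | 0 ≤ x z} ∩ {z | 0 ≤ y z} ∩ {z | x z + y z ≤ 1}
  have hU : IsOpen U := ((isOpen_lt continuous_const hx).inter (isOpen_lt continuous_const hy)).inter
    (isOpen_lt (hx.add hy) continuous_const)
  have hV : IsClosed V := ((isClosed_le continuous_const hx).inter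
    (isClosed_le continuous_const hy)).inter (isClosed_le (hx.add hy) continuous_const)
  have hUV : closure U ⊆ V := by
    refine closure_minimal ?_ hV
    rintro z ⟨⟨p, q⟩, r⟩
    simp only [Set.mem_ofPred_eq] at p q r
    exact ⟨⟨p.le, q.le⟩, r.le⟩
  have hVU : V ∩ (disc C₀ ∪ disc C ∪ disc C')ᶜ ⊆ U := by
    rintro z ⟨⟨⟨p, q⟩, r⟩, hz⟩
    simp only [Set.mem_ofPred_eq] at p q r
    have hz1 : z ∉ disc C₀ ∪ disc C := fun h ↦ hz (Or.inl h)
    have hz2 : z ∉ disc C₀ ∪ disc C' := fun h ↦ hz (h.elim (fun h ↦ .inl (.inl h)) .inr)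
    have hz3 : z ∉ disc C ∪ disc C' := fun h ↦ hz (h.elim (fun h ↦ .inl (.inr h)) .inr)
    refine ⟨⟨lt_of_le_of_ne p fun h0 ↦ hz2 ?_, lt_of_le_of_ne q fun h0 ↦ hz1 ?_⟩,
      lt_of_le_of_ne r fun h0 ↦ hz3 ?_⟩
    · refine segment_subset_disc_union h2 ⟨1 - y z, y z, by linarith, q, by ring, ?_⟩
      conv_rhs => rw [hrep z, ← h0]
      simp only [v, Complex.real_smul]
      push_cast
      ring
    · refine segment_subset_disc_union h1 ⟨1 - x z, x z, by linarith, p, by ring, ?_⟩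
      conv_rhs => rw [hrep z, ← h0]
      simp only [v, Complex.real_smul]
      push_cast
      ring
    · refine segment_subset_disc_union h3 ⟨x z, y z, p, q, h0, ?_⟩
      have h0' : y z = 1 - x z := by linarith
      conv_rhs => rw [hrep z, h0']
      simp only [v, Complex.real_smul, h0']
      push_cast
      ring
  have hsub : connectedComponentIn (disc C₀ ∪ disc C ∪ disc C')ᶜ s ⊆ U := by
    refine isPreconnected_connectedComponentIn.subset_of_closure_inter_subset hU
      ⟨s, mem_connectedComponentIn hs, ?_⟩ ?_
    · refine ⟨⟨?_, ?_⟩, ?_⟩ <;> simp only [Set.mem_ofPred_eq, hxs, hys] <;> assumption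
    · rintro z ⟨hz, hz'⟩
      exact hVU ⟨hUV hz, connectedComponentIn_subset _ _ hz'⟩
  refine (isBounded_iff_forall_norm_le.2
    ⟨‖C₀.center‖ + ‖v C₀ C‖ + ‖v C₀ C'‖, ?_⟩ : Bornology.IsBounded U).subset hsub
  rintro z ⟨⟨p, q⟩, r⟩
  simp only [Set.mem_ofPred_eq] at p q r
  rw [hrep z]
  refine (norm_add₃_le).trans ?_
  rw [norm_mul, norm_mul, Complex.norm_real, Complex.norm_real, Real.norm_of_nonneg p.le,
    Real.norm_of_nonneg q.le]
  have := norm_nonneg (v C₀ C)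
  have := norm_nonneg (v C₀ C')
  gcongr <;> nlinarith

/-- Along the ray from `s` in direction `n` the distance to each center never falls below its
initial value, so the ray escapes to infinity without meeting a disc. -/
lemma not_isBounded_connectedComponentIn_of_separated {C₀ C C' : PlaneCircle} {s n : ℂ}
    (hn : n ≠ 0) (hs : s ∈ (disc C₀ ∪ disc C ∪ disc C')ᶜ)
    (h0 : dot n (C₀.center - s) ≤ 0) (h1 : dot n (C.center - s) ≤ 0)
    (h2 : dot n (C'.center - s) ≤ 0) :
    ¬ Bornology.IsBounded (connectedComponentIn (disc C₀ ∪ disc C ∪ disc C')ᶜ s) := by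
  have hray (c : ℂ) (hc : dot n (c - s) ≤ 0) (t : ℝ) (ht : 0 ≤ t) :
      dist s c ≤ dist (s + t * n) c := by
    rw [dist_eq_norm, dist_eq_norm, ← sq_le_sq₀ (norm_nonneg _) (norm_nonneg _),
      ← Complex.normSq_eq_norm_sq, ← Complex.normSq_eq_norm_sq]
    have : Complex.normSq (s + t * n - c) =
        Complex.normSq (s - c) - 2 * (t * dot n (c - s)) + t ^ 2 * Complex.normSq n := by
      simp only [Complex.normSq_apply, dot, Complex.sub_re, Complex.sub_im, Complex.add_re,
        Complex.add_im, Complex.re_ofReal_mul, Complex.im_ofReal_mul]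
      ring
    have h3 := mul_nonpos_of_nonneg_of_nonpos ht hc
    have h4 := mul_nonneg (sq_nonneg t) (Complex.normSq_nonneg n)
    linarith
  let f : ℝ → ℂ := fun t ↦ s + t * n
  have hf : Continuous f := by unfold f; fun_prop
  have hsub : f '' Set.Ici 0 ⊆ connectedComponentIn (disc C₀ ∪ disc C ∪ disc C')ᶜ s := by
    refine (isPreconnected_Ici.image f hf.continuousOn).subset_connectedComponentIn
      ⟨0, Set.self_mem_Ici, by simp [f]⟩ ?_
    rintro _ ⟨t, ht, rfl⟩
    simp only [disc, Set.mem_compl_iff, Set.mem_union, Metric.mem_closedBall, not_or,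
      not_le] at hs ⊢
    exact ⟨⟨hs.1.1.trans_le (hray _ h0 t ht), hs.1.2.trans_le (hray _ h1 t ht)⟩,
      hs.2.trans_le (hray _ h2 t ht)⟩
  intro hb
  obtain ⟨M, hM⟩ := isBounded_iff_forall_norm_le.1 (hb.subset hsub)
  have hn' : 0 < ‖n‖ := norm_pos_iff.2 hn
  have hM0 : 0 ≤ M := (norm_nonneg _).trans (hM _ ⟨0, Set.self_mem_Ici, rfl⟩)
  have ht : 0 ≤ (M + ‖s‖ + 1) / ‖n‖ := by positivity
  have h3 := hM _ ⟨(M + ‖s‖ + 1) / ‖n‖, ht, rfl⟩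
  have h4 : ‖(((M + ‖s‖ + 1) / ‖n‖ : ℝ) : ℂ) * n‖ = M + ‖s‖ + 1 := by
    rw [norm_mul, Complex.norm_real, Real.norm_of_nonneg ht]
    field_simp
  have h5 := norm_sub_le (f ((M + ‖s‖ + 1) / ‖n‖)) s
  have h6 : f ((M + ‖s‖ + 1) / ‖n‖) - s = (((M + ‖s‖ + 1) / ‖n‖ : ℝ) : ℂ) * n := by
    simp [f]
  rw [h6, h4] at h5
  linarith

/-! ### The successor has spinor `ψ + φ` -/

lemma center_notMem_disc {C S : PlaneCircle} (h : C.IsExtTangent S) (hS : 0 < S.radius) :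
    S.center ∉ disc C := by
  simp only [disc, Metric.mem_closedBall, dist_comm S.center, h.dist_center]
  linarith

lemma normSq_add_eq (ψ φ : ℂ) :
    Complex.normSq (ψ + φ) = Complex.normSq ψ + Complex.normSq φ + 2 * dot ψ φ := by
  simp only [Complex.normSq_apply, dot, Complex.add_re, Complex.add_im]
  ring

lemma one_lt_normSq_add {ψ φ : ℂ} (hψ : 1 < Complex.normSq ψ) (hφ : 1 < Complex.normSq φ)
    (hdot : 0 < dot ψ φ) : 1 < Complex.normSq (ψ + φ) := by
  rw [normSq_add_eq]
  linarith

lemma dot_mul_add_sq (ψ φ : ℂ) :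
    (dot ψ φ : ℂ) * (ψ + φ) ^ 2 = ((dot ψ φ + Complex.normSq φ : ℝ) : ℂ) * ψ ^ 2 +
      ((dot ψ φ + Complex.normSq ψ : ℝ) : ℂ) * φ ^ 2 := by
  apply Complex.ext <;>
  · simp only [Complex.normSq_apply, dot, Complex.add_re, Complex.add_im, pow_two, Complex.mul_re,
      Complex.mul_im, Complex.ofReal_re, Complex.ofReal_im]
    ring

lemma dot_I_mul_sq (ψ φ : ℂ) :
    dot (Complex.I * φ ^ 2) (ψ ^ 2) = 2 * dot ψ φ * det φ ψ := by
  simp only [det, dot, pow_two, Complex.mul_re, Complex.mul_im, Complex.I_re, Complex.I_im]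
  ring

lemma det_sq_sq (ψ φ : ℂ) : det (ψ ^ 2) (φ ^ 2) = 2 * dot ψ φ * det ψ φ := by
  simp only [det, dot, pow_two, Complex.mul_re, Complex.mul_im]
  ring

lemma det_comm_neg (ψ φ : ℂ) : det φ ψ = -det ψ φ := by
  simp only [det]
  ring

lemma dot_comm (ψ φ : ℂ) : dot φ ψ = dot ψ φ := by
  simp only [dot]
  ring

lemma det_real_mul (a b : ℝ) (ψ φ : ℂ) : det (a * ψ) (b * φ) = a * b * det ψ φ := by
  simp only [det, Complex.re_ofReal_mul, Complex.im_ofReal_mul]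
  ring

lemma isSuccessor_spinorCircle_add {C₀ : PlaneCircle} (h₀ : 0 < C₀.radius) {ψ φ : ℂ}
    (hψ : 1 < Complex.normSq ψ) (hφ : 1 < Complex.normSq φ) (hdet : det ψ φ ^ 2 = 1)
    (hdot : 0 < dot ψ φ) :
    IsSuccessor C₀ (spinorCircle C₀ ψ) (spinorCircle C₀ φ) (spinorCircle C₀ (ψ + φ)) := by
  have hχ := one_lt_normSq_add hψ hφ hdot
  have hS := spinorCircle_radius_pos h₀ hχ
  have t0 := isExtTangent_spinorCircle h₀ hχ
  have t1 : (spinorCircle C₀ ψ).IsExtTangent (spinorCircle C₀ (ψ + φ)) := by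
    rw [spinorCircle_isExtTangent_iff h₀ hψ hχ, ← hdet]
    simp only [det, Complex.add_re, Complex.add_im]
    ring
  have t2 : (spinorCircle C₀ φ).IsExtTangent (spinorCircle C₀ (ψ + φ)) := by
    rw [spinorCircle_isExtTangent_iff h₀ hφ hχ, ← hdet]
    simp only [det, Complex.add_re, Complex.add_im]
    ring
  refine ⟨hS, t0, t1, t2, ?_⟩
  have p1 := spinorCircle_radius_pos h₀ hψ
  have p2 := spinorCircle_radius_pos h₀ hφ
  have hAB := dot_sq_add_det_sq ψ φ
  rw [hdet] at hAB
  have hdet0 : det ψ φ ≠ 0 := fun h ↦ by simp [h] at hdet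
  -- The coefficients come from `dot_mul_add_sq` divided by `dot ψ φ`; the radii convert squares of
  -- spinors into the vectors `v`.
  refine isBounded_connectedComponentIn_of_mem_triangle (isExtTangent_spinorCircle h₀ hψ)
    (isExtTangent_spinorCircle h₀ hφ) ((spinorCircle_isExtTangent_iff h₀ hψ hφ).2 hdet) ?_ ?_
    (a := (spinorCircle C₀ (ψ + φ)).radius * (1 + Complex.normSq φ / dot ψ φ) /
      (spinorCircle C₀ ψ).radius)
    (b := (spinorCircle C₀ (ψ + φ)).radius * (1 + Complex.normSq ψ / dot ψ φ) /
      (spinorCircle C₀ φ).radius) ?_ ?_ ?_ ?_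
  · rw [v_spinorCircle, v_spinorCircle, det_real_mul, det_sq_sq]
    positivity
  · simp only [Set.mem_compl_iff, Set.mem_union, not_or]
    exact ⟨⟨center_notMem_disc t0 hS, center_notMem_disc t1 hS⟩, center_notMem_disc t2 hS⟩
  · have := Complex.normSq_nonneg φ
    positivity
  · have := Complex.normSq_nonneg ψ
    positivity
  · simp only [spinorCircle]
    rw [normSq_add_eq]
    have q1 : 0 < Complex.normSq ψ - 1 := by linarith
    have q2 : 0 < Complex.normSq φ - 1 := by linarith
    have q3 : 0 < Complex.normSq ψ + Complex.normSq φ + 2 * dot ψ φ - 1 := by linarith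
    generalize Complex.normSq ψ = A at *
    generalize Complex.normSq φ = B at *
    generalize dot ψ φ = d at *
    have e : C₀.radius / (A + B + 2 * d - 1) * (1 + B / d) / (C₀.radius / (A - 1)) +
        C₀.radius / (A + B + 2 * d - 1) * (1 + A / d) / (C₀.radius / (B - 1)) =
        ((d + B) * (A - 1) + (d + A) * (B - 1)) / (d * (A + B + 2 * d - 1)) := by
      field_simp
    -- With `A B = d² + 1` the inequality reduces to `2 < A + B + d`.
    rw [e, div_lt_one (by positivity)]
    nlinarith
  · change v C₀ _ = _
    rw [v_spinorCircle, v_spinorCircle, v_spinorCircle]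
    have c1 : ((spinorCircle C₀ ψ).radius : ℂ) ≠ 0 := by exact_mod_cast p1.ne'
    have c2 : ((spinorCircle C₀ φ).radius : ℂ) ≠ 0 := by exact_mod_cast p2.ne'
    have c3 : (dot ψ φ : ℂ) ≠ 0 := by exact_mod_cast hdot.ne'
    have := dot_mul_add_sq ψ φ
    push_cast at this ⊢
    field_simp
    linear_combination ((spinorCircle C₀ (ψ + φ)).radius : ℂ) * this

/-- The line through the centers of `C₀` and of the circle of `φ` separates the new center from the
circle of `ψ`: `n` is a normal of that line, with `n · ψ² = -2 d < 0` and `n · (ψ - φ)² = 2 (|φ|² -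
d) > 0`, where `d = dot ψ φ`. -/
lemma not_isBounded_spinorCircle_sub {C₀ : PlaneCircle} (h₀ : 0 < C₀.radius) {ψ φ : ℂ}
    (hψ : 1 < Complex.normSq ψ) (hdet : det ψ φ ^ 2 = 1) (hdot : 0 < dot ψ φ)
    (hχ : 1 < Complex.normSq (ψ - φ)) (hlt : dot ψ φ < Complex.normSq φ)
    (hs : (spinorCircle C₀ (ψ - φ)).center ∈
      (disc C₀ ∪ disc (spinorCircle C₀ ψ) ∪ disc (spinorCircle C₀ φ))ᶜ) :
    ¬ Bornology.IsBounded (connectedComponentIn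
      (disc C₀ ∪ disc (spinorCircle C₀ ψ) ∪ disc (spinorCircle C₀ φ))ᶜ
      (spinorCircle C₀ (ψ - φ)).center) := by
  have p1 := spinorCircle_radius_pos h₀ hψ
  have hS := spinorCircle_radius_pos h₀ hχ
  let n : ℂ := ((-det φ ψ : ℝ) : ℂ) * (Complex.I * φ ^ 2)
  have hdet' : det φ ψ ^ 2 = 1 := by rw [det_comm_neg, neg_sq, hdet]
  have hdet0 : det φ ψ ≠ 0 := fun h ↦ by simp [h] at hdet'
  have dot_add (a b c : ℂ) : dot a (b + c) = dot a b + dot a c := by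
    simp only [dot, Complex.add_re, Complex.add_im]; ring
  have dot_neg (a b : ℂ) : dot a (-b) = -dot a b := by
    simp only [dot, Complex.neg_re, Complex.neg_im]; ring
  have dot_mul (r : ℝ) (a b : ℂ) : dot a (r * b) = r * dot a b := by
    simp only [dot, Complex.re_ofReal_mul, Complex.im_ofReal_mul]; ring
  have mul_dot (r : ℝ) (a b : ℂ) : dot (r * a) b = r * dot a b := by
    simp only [dot, Complex.re_ofReal_mul, Complex.im_ofReal_mul]; ring
  have hnψ : dot n (ψ ^ 2) = -2 * dot ψ φ := by
    simp only [n]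
    rw [mul_dot, dot_I_mul_sq]
    linear_combination (-2 * dot ψ φ) * hdet'
  have hnφ : dot n (φ ^ 2) = 0 := by
    simp only [n]
    rw [mul_dot]
    simp only [dot, pow_two, Complex.mul_re, Complex.mul_im, Complex.I_re, Complex.I_im]
    ring
  have hnχ : dot n ((ψ - φ) ^ 2) = 2 * (Complex.normSq φ - dot ψ φ) := by
    have h1 := congrArg (dot n) (dot_mul_add_sq ψ (-φ))
    have h2 : dot ψ (-φ) = - dot ψ φ := dot_neg _ _
    rw [dot_add, dot_mul, dot_mul, dot_mul, neg_sq, hnψ, hnφ, h2, Complex.normSq_neg,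
      ← sub_eq_add_neg] at h1
    apply mul_left_cancel₀ hdot.ne'
    linear_combination -h1
  have hn : n ≠ 0 := by
    intro h
    rw [h] at hnψ
    simp only [dot, Complex.zero_re, Complex.zero_im] at hnψ hdot
    linarith
  have hpos : 0 < dot n (v C₀ (spinorCircle C₀ (ψ - φ))) := by
    rw [v_spinorCircle, dot_mul, hnχ]
    have : 0 < Complex.normSq φ - dot ψ φ := by linarith
    positivity
  have hcs (C : PlaneCircle) : C.center - (spinorCircle C₀ (ψ - φ)).center =
      v C₀ C + -v C₀ (spinorCircle C₀ (ψ - φ)) := by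
    simp only [v]; ring
  refine not_isBounded_connectedComponentIn_of_separated hn hs ?_ ?_ ?_
  · rw [hcs, dot_add, dot_neg]
    simp only [v, sub_self, dot, Complex.zero_re, Complex.zero_im] at hpos ⊢
    linarith
  · rw [hcs, dot_add, dot_neg, v_spinorCircle, dot_mul, hnψ]
    have := mul_pos p1 hdot
    linarith
  · rw [hcs, dot_add, dot_neg, v_spinorCircle C₀ φ, dot_mul, hnφ]
    linarith

lemma eq_add_or_sub_of_det_sq {ψ φ χ : ℂ} (h : det ψ φ ^ 2 = 1) (h1 : det ψ χ ^ 2 = 1)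
    (h2 : det φ χ ^ 2 = 1) :
    (χ = ψ + φ ∨ χ = -(ψ + φ)) ∨ (χ = ψ - φ ∨ χ = -(ψ - φ)) := by
  -- Cramer's rule: the coordinates of `χ` in the basis `ψ`, `φ` are all `±1`.
  have key : (det ψ φ : ℂ) * χ = -(det φ χ : ℂ) * ψ + (det ψ χ : ℂ) * φ := by
    apply Complex.ext <;>
    · simp only [det, Complex.add_re, Complex.add_im, Complex.mul_re, Complex.neg_re,
        Complex.neg_im, Complex.mul_im, Complex.ofReal_re, Complex.ofReal_im]
      ring
  rcases sq_eq_one_iff.1 h with e | e <;> rcases sq_eq_one_iff.1 h1 with e1 | e1 <;>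
    rcases sq_eq_one_iff.1 h2 with e2 | e2 <;> rw [e, e1, e2] at key <;> push_cast at key
  · exact .inr (.inr (by linear_combination key))
  · exact .inl (.inl (by linear_combination key))
  · exact .inl (.inr (by linear_combination key))
  · exact .inr (.inl (by linear_combination key))
  · exact .inr (.inl (by linear_combination -key))
  · exact .inl (.inr (by linear_combination -key))
  · exact .inl (.inl (by linear_combination -key))
  · exact .inr (.inr (by linear_combination -key))

lemma isSuccessor_iff {C₀ : PlaneCircle} (h₀ : 0 < C₀.radius) {ψ φ : ℂ}
    (hψ : 1 < Complex.normSq ψ) (hφ : 1 < Complex.normSq φ) (hdet : det ψ φ ^ 2 = 1)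
    (hdot : 0 < dot ψ φ) {S : PlaneCircle} :
    IsSuccessor C₀ (spinorCircle C₀ ψ) (spinorCircle C₀ φ) S ↔ S = spinorCircle C₀ (ψ + φ) := by
  refine ⟨fun ⟨hS, t0, t1, t2, hb⟩ ↦ ?_, fun h ↦ h ▸ isSuccessor_spinorCircle_add h₀ hψ hφ hdet hdot⟩
  have hs : S.center ∈ (disc C₀ ∪ disc (spinorCircle C₀ ψ) ∪ disc (spinorCircle C₀ φ))ᶜ := by
    simp only [Set.mem_compl_iff, Set.mem_union, not_or]
    exact ⟨⟨center_notMem_disc t0 hS, center_notMem_disc t1 hS⟩, center_notMem_disc t2 hS⟩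
  obtain ⟨χ, hχ, rfl⟩ := exists_eq_spinorCircle h₀ hS t0
  rw [spinorCircle_isExtTangent_iff h₀ hψ hχ] at t1
  rw [spinorCircle_isExtTangent_iff h₀ hφ hχ] at t2
  have hsub (h : spinorCircle C₀ χ = spinorCircle C₀ (ψ - φ)) (h' : 1 < Complex.normSq (ψ - φ)) :
      False := by
    rw [h] at hs hb
    -- Since `|ψ|² |φ|² = d² + 1` for `d = dot ψ φ`, at least one of `d < |φ|²` and `d < |ψ|²`
    -- holds; the second case is the first with the two circles exchanged.
    by_cases hlt : dot ψ φ < Complex.normSq φ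
    · exact not_isBounded_spinorCircle_sub h₀ hψ hdet hdot h' hlt hs hb
    · have hlt' : dot φ ψ < Complex.normSq ψ := by
        have hAB := dot_sq_add_det_sq ψ φ
        rw [dot_comm]
        by_contra! h3
        nlinarith
      rw [← spinorCircle_neg _ (ψ - φ), neg_sub, Set.union_right_comm] at hs hb
      refine not_isBounded_spinorCircle_sub h₀ hφ (by rw [det_comm_neg, neg_sq, hdet])
        (by rwa [dot_comm]) ?_ hlt' hs hb
      rwa [← Complex.normSq_neg, neg_sub]
  rcases eq_add_or_sub_of_det_sq hdet t1 t2 with (rfl | rfl) | (rfl | rfl)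
  · rfl
  · exact spinorCircle_neg _ _
  · exact (hsub rfl hχ).elim
  · exact (hsub (spinorCircle_neg _ _) (by rwa [Complex.normSq_neg] at hχ)).elim

/-! ### The self-similar curve over the Farey map -/

/-- The inverse of the branch `s ↦ s / (1 + s)` of the Farey map, extended by `1`. -/
def fareyLeft (s : ℝ) : ℝ := min s (1 / 2) / (1 - min s (1 / 2))

/-- The inverse of the branch `s ↦ 1 / (2 - s)` of the Farey map, extended by `0`. -/
def fareyRight (s : ℝ) : ℝ := (2 * max s (1 / 2) - 1) / max s (1 / 2)

lemma continuous_fareyLeft : Continuous fareyLeft := by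
  unfold fareyLeft
  refine Continuous.div (by fun_prop) (by fun_prop) fun s ↦ ?_
  have := min_le_right s (1 / 2)
  linarith

lemma continuous_fareyRight : Continuous fareyRight := by
  unfold fareyRight
  refine Continuous.div (by fun_prop) (by fun_prop) fun s ↦ ?_
  have := le_max_right s (1 / 2)
  linarith

lemma fareyLeft_mem {s : ℝ} (hs : s ∈ Set.Icc (0 : ℝ) 1) : fareyLeft s ∈ Set.Icc (0 : ℝ) 1 := by
  have h1 := min_le_right s (1 / 2)
  have h2 : 0 ≤ min s (1 / 2) := le_min hs.1 (by norm_num)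
  exact ⟨div_nonneg h2 (by linarith), div_le_one_of_le₀ (by linarith) (by linarith)⟩

lemma fareyRight_mem {s : ℝ} (hs : s ∈ Set.Icc (0 : ℝ) 1) : fareyRight s ∈ Set.Icc (0 : ℝ) 1 := by
  have h1 := le_max_right s (1 / 2)
  have h2 : max s (1 / 2) ≤ 1 := max_le hs.2 (by norm_num)
  exact ⟨div_nonneg (by linarith) (by linarith), div_le_one_of_le₀ (by linarith) (by linarith)⟩

lemma fareyLeft_of_le {s : ℝ} (hs : s ≤ 1 / 2) : fareyLeft s = s / (1 - s) := by
  rw [fareyLeft, min_eq_left hs]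

lemma fareyLeft_of_ge {s : ℝ} (hs : 1 / 2 ≤ s) : fareyLeft s = 1 := by
  rw [fareyLeft, min_eq_right hs]
  norm_num

lemma fareyRight_of_ge {s : ℝ} (hs : 1 / 2 ≤ s) : fareyRight s = (2 * s - 1) / s := by
  rw [fareyRight, max_eq_left hs]

lemma fareyRight_of_le {s : ℝ} (hs : s ≤ 1 / 2) : fareyRight s = 0 := by
  rw [fareyRight, max_eq_right hs]
  norm_num

/-- The operator whose fixed point describes the Apollonian curve in the coordinates given by the
spinors of the two circles. -/
def fareyOperator (F : C(unitInterval, ℝ × ℝ)) : C(unitInterval, ℝ × ℝ) where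
  toFun s :=
    let P := F ⟨fareyLeft s, fareyLeft_mem s.2⟩
    let Q := F ⟨fareyRight s, fareyRight_mem s.2⟩
    ((P.1 + (Q.1 + Q.2)) / 3, ((P.1 + P.2) + Q.2) / 3)
  continuous_toFun := by
    have h1 : Continuous fun s : unitInterval ↦
        (⟨fareyLeft s, fareyLeft_mem s.2⟩ : unitInterval) :=
      (continuous_fareyLeft.comp continuous_subtype_val).subtype_mk _
    have h2 : Continuous fun s : unitInterval ↦
        (⟨fareyRight s, fareyRight_mem s.2⟩ : unitInterval) :=
      (continuous_fareyRight.comp continuous_subtype_val).subtype_mk _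
    have h3 := F.continuous.comp h1
    have h4 := F.continuous.comp h2
    exact ((h3.fst.add (h4.fst.add h4.snd)).div_const 3).prodMk
      (((h3.fst.add h3.snd).add h4.snd).div_const 3)

/-- Curves from `(0, 0)` to `(1, 1)`. -/
def diagonalPaths : Set C(unitInterval, ℝ × ℝ) := {F | F 0 = (0, 0) ∧ F 1 = (1, 1)}

/-- On each half the truncated inverse branch of the other half is constant, at a point where the
end conditions fix `F`. One formula thus gives both affine pieces, with no gluing at `1/2`. -/
lemma fareyOperator_of_le (F : C(unitInterval, ℝ × ℝ)) (hF : F ∈ diagonalPaths)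
    {s : unitInterval} (hs : (s : ℝ) ≤ 1 / 2) :
    fareyOperator F s = ((F ⟨fareyLeft s, fareyLeft_mem s.2⟩).1 / 3,
      ((F ⟨fareyLeft s, fareyLeft_mem s.2⟩).1 + (F ⟨fareyLeft s, fareyLeft_mem s.2⟩).2) / 3) := by
  have h : (⟨fareyRight s, fareyRight_mem s.2⟩ : unitInterval) = 0 :=
    Subtype.ext (fareyRight_of_le hs)
  simp [fareyOperator, h, hF.1]

lemma fareyOperator_of_ge (F : C(unitInterval, ℝ × ℝ)) (hF : F ∈ diagonalPaths)
    {s : unitInterval} (hs : 1 / 2 ≤ (s : ℝ)) :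
    fareyOperator F s = ((1 + ((F ⟨fareyRight s, fareyRight_mem s.2⟩).1 +
        (F ⟨fareyRight s, fareyRight_mem s.2⟩).2)) / 3,
      (2 + (F ⟨fareyRight s, fareyRight_mem s.2⟩).2) / 3) := by
  have h : (⟨fareyLeft s, fareyLeft_mem s.2⟩ : unitInterval) = 1 :=
    Subtype.ext (fareyLeft_of_ge hs)
  simp [fareyOperator, h, hF.2]
  norm_num

lemma fareyOperator_mapsTo : Set.MapsTo fareyOperator diagonalPaths diagonalPaths := by
  intro F hF
  constructor
  · have h : (⟨fareyLeft (0 : unitInterval), fareyLeft_mem (0 : unitInterval).2⟩ : unitInterval) =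
        0 :=
      Subtype.ext ((fareyLeft_of_le (by norm_num)).trans (by norm_num))
    rw [fareyOperator_of_le F hF (by norm_num), h, hF.1]
    norm_num
  · have h : (⟨fareyRight (1 : unitInterval), fareyRight_mem (1 : unitInterval).2⟩ :
        unitInterval) = 1 :=
      Subtype.ext ((fareyRight_of_ge (by norm_num)).trans (by norm_num))
    rw [fareyOperator_of_ge F hF (by norm_num), h, hF.2]
    norm_num

/-- On each half the operator is an affine map of a single value of `F`; each row of its linear part
has at most two entries `1/3` and zeros otherwise, whence the factor `2/3` in the sup norm. -/
lemma dist_fareyOperator_le {F G : C(unitInterval, ℝ × ℝ)} (hF : F ∈ diagonalPaths)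
    (hG : G ∈ diagonalPaths) :
    dist (fareyOperator F) (fareyOperator G) ≤ 2 / 3 * dist F G := by
  rw [ContinuousMap.dist_le (by positivity)]
  intro s
  have hd (t : unitInterval) : |(F t).1 - (G t).1| ≤ dist F G ∧ |(F t).2 - (G t).2| ≤ dist F G := by
    have := F.dist_apply_le_dist (g := G) t
    rw [Prod.dist_eq, max_le_iff] at this
    exact this
  rcases le_total (s : ℝ) (1 / 2) with hs | hs
  · rw [fareyOperator_of_le F hF hs, fareyOperator_of_le G hG hs, Prod.dist_eq, max_le_iff,
      Real.dist_eq, Real.dist_eq]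
    obtain ⟨h1, h2⟩ := hd ⟨fareyLeft s, fareyLeft_mem s.2⟩
    rw [abs_le] at h1 h2
    constructor <;> rw [abs_le] <;> constructor <;> dsimp only <;> linarith
  · rw [fareyOperator_of_ge F hF hs, fareyOperator_of_ge G hG hs, Prod.dist_eq, max_le_iff,
      Real.dist_eq, Real.dist_eq]
    obtain ⟨h1, h2⟩ := hd ⟨fareyRight s, fareyRight_mem s.2⟩
    rw [abs_le] at h1 h2
    constructor <;> rw [abs_le] <;> constructor <;> dsimp only <;> linarith

lemma isComplete_diagonalPaths : IsComplete diagonalPaths := by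
  refine IsClosed.isComplete ?_
  exact (isClosed_eq (continuous_eval_const 0) continuous_const).inter
    (isClosed_eq (continuous_eval_const 1) continuous_const)

/-- The functional equations of the curve describing an Apollonian curve in spinor coordinates. -/
structure IsFareyCurve (G : ℝ → ℝ × ℝ) : Prop where
  continuous : Continuous G
  zero : G 0 = (0, 0)
  one : G 1 = (1, 1)
  left : ∀ s, 0 ≤ s → s ≤ 1 / 2 →
    G s = ((G (s / (1 - s))).1 / 3, ((G (s / (1 - s))).1 + (G (s / (1 - s))).2) / 3)
  right : ∀ s, 1 / 2 ≤ s → s ≤ 1 →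
    G s = ((1 + ((G ((2 * s - 1) / s)).1 + (G ((2 * s - 1) / s)).2)) / 3,
      (2 + (G ((2 * s - 1) / s)).2) / 3)

lemma exists_fareyCurve : ∃ G : ℝ → ℝ × ℝ, IsFareyCurve G := by
  have hc : ContractingWith (2 / 3) (fareyOperator_mapsTo.restrict fareyOperator _ _) := by
    refine ⟨by norm_num [← NNReal.coe_lt_coe], LipschitzWith.of_dist_le_mul fun F G ↦ ?_⟩
    exact (dist_fareyOperator_le F.2 G.2).trans_eq (by simp [Subtype.dist_eq])
  have hmem : (⟨fun s : unitInterval ↦ ((s : ℝ), (s : ℝ)), by fun_prop⟩ :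
      C(unitInterval, ℝ × ℝ)) ∈ diagonalPaths := ⟨by simp, by simp⟩
  obtain ⟨F, hF, hfix, -⟩ := hc.exists_fixedPoint' isComplete_diagonalPaths fareyOperator_mapsTo
    hmem (edist_ne_top _ _)
  have hev (s : ℝ) (hs : s ∈ Set.Icc (0 : ℝ) 1) :
      Set.IccExtend zero_le_one F s = F ⟨s, hs⟩ := Set.IccExtend_of_mem _ _ hs
  refine ⟨Set.IccExtend zero_le_one F, F.continuous.Icc_extend', ?_, ?_, ?_, ?_⟩
  · rw [hev 0 (by simp)]
    exact hF.1
  · rw [hev 1 (by simp)]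
    exact hF.2
  · intro s h0 h1
    have hs : s ∈ Set.Icc (0 : ℝ) 1 := ⟨h0, by linarith⟩
    rw [← fareyLeft_of_le h1, hev s hs, hev _ (fareyLeft_mem hs),
      ← fareyOperator_of_le F hF (s := ⟨s, hs⟩) h1, hfix]
  · intro s h0 h1
    have hs : s ∈ Set.Icc (0 : ℝ) 1 := ⟨by linarith, h1⟩
    rw [← fareyRight_of_ge h0, hev s hs, hev _ (fareyRight_mem hs),
      ← fareyOperator_of_ge F hF (s := ⟨s, hs⟩) h0, hfix]

lemma IsFareyCurve.left_natCast {G : ℝ → ℝ × ℝ} (hG : IsFareyCurve G) {p m : ℕ}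
    (h : 0 < p + m) :
    G ((p : ℝ) / (p + (p + m : ℕ))) = ((G ((p : ℝ) / (p + m))).1 / 3,
      ((G ((p : ℝ) / (p + m))).1 + (G ((p : ℝ) / (p + m))).2) / 3) := by
  have h' : (0 : ℝ) < p + m := by exact_mod_cast h
  have hp : (0 : ℝ) ≤ p := p.cast_nonneg
  have hm : (0 : ℝ) ≤ m := m.cast_nonneg
  have e : (p : ℝ) / (p + (p + m)) / (1 - (p : ℝ) / (p + (p + m))) = p / (p + m) := by
    have : (p : ℝ) + (p + m) ≠ 0 := by positivity
    have e1 : 1 - (p : ℝ) / (p + (p + m)) = (p + m) / (p + (p + m)) := by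
      field_simp
      ring
    rw [e1]
    field_simp
  have := hG.left ((p : ℝ) / (p + (p + m))) (by positivity) (by
    rw [div_le_div_iff₀ (by positivity) (by norm_num)]
    linarith)
  rw [e] at this
  push_cast
  exact this

lemma IsFareyCurve.right_natCast {G : ℝ → ℝ × ℝ} (hG : IsFareyCurve G) {m q : ℕ}
    (h : 0 < m + q) :
    G (((m + q : ℕ) : ℝ) / ((m + q : ℕ) + q)) =
      ((1 + ((G ((m : ℝ) / (m + q))).1 + (G ((m : ℝ) / (m + q))).2)) / 3,
        (2 + (G ((m : ℝ) / (m + q))).2) / 3) := by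
  have h' : (0 : ℝ) < m + q := by exact_mod_cast h
  have hq : (0 : ℝ) ≤ q := q.cast_nonneg
  have hm : (0 : ℝ) ≤ m := m.cast_nonneg
  have e : (2 * (((m : ℝ) + q) / (m + q + q)) - 1) / (((m : ℝ) + q) / (m + q + q)) =
      m / (m + q) := by
    have : (m : ℝ) + q + q ≠ 0 := by positivity
    have e1 : 2 * (((m : ℝ) + q) / (m + q + q)) - 1 = m / (m + q + q) := by
      field_simp
      ring
    rw [e1]
    field_simp
  have := hG.right (((m : ℝ) + q) / (m + q + q)) (by
    rw [div_le_div_iff₀ (by norm_num) (by positivity)]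
    linarith) (div_le_one_of_le₀ (by linarith) (by linarith))
  rw [e] at this
  push_cast
  exact this

/-- The parameters `p / (p + q)` and `p' / (p' + q')` lie strictly on both sides of `1/2`. Then `(p
+ 1)(q' + 1) ≤ q p' ≤ p q' + 1`, which leaves only the two end points. -/
lemma eq_one_of_farey_apart {p q p' q' : ℕ} (h : ((p : ℤ) * q' - q * p') ^ 2 = 1) (h1 : p < q)
    (h2 : q' < p') : p = 0 ∧ q = 1 ∧ p' = 1 ∧ q' = 0 := by
  have h3 : (p + 1) * (q' + 1) ≤ q * p' := Nat.mul_le_mul h1 h2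
  zify at h3
  have h4 : (p : ℤ) * q' - q * p' = -1 := by
    rcases sq_eq_one_iff.1 h with h | h
    · nlinarith
    · exact h
  have hp : p = 0 := by nlinarith
  have hq : q' = 0 := by nlinarith
  subst hp hq
  have h5 : q * p' = 1 := by
    zify
    push_cast at h4
    linarith
  exact ⟨rfl, Nat.eq_one_of_mul_eq_one_right h5, Nat.eq_one_of_mul_eq_one_left h5, rfl⟩

/-- Subtractive Euclid: two tangent circles in the same half come from a tangent pair with smaller
coefficients, and the affine piece carries the direction `(p + p', q + q')` of one pair to that of
the other. The only pair not in a common half is the pair of end points. -/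
lemma IsFareyCurve.chord {G : ℝ → ℝ × ℝ} (hG : IsFareyCurve G) {p q p' q' : ℕ}
    (h : ((p : ℤ) * q' - q * p') ^ 2 = 1) :
    ∃ k : ℝ, G ((p : ℝ) / (p + q)) - G ((p' : ℝ) / (p' + q')) =
      (k * (p + p'), k * (q + q')) := by
  induction hn : p + q + p' + q' using Nat.strong_induction_on generalizing p q p' q' with
  | _ n ih =>
  subst hn
  by_cases hR : q ≤ p ∧ q' ≤ p'
  · obtain ⟨h1, h2⟩ := hR
    obtain ⟨m, rfl⟩ := Nat.exists_eq_add_of_le' h1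
    obtain ⟨m', rfl⟩ := Nat.exists_eq_add_of_le' h2
    have h3 : ((m : ℤ) * q' - q * m') ^ 2 = 1 := by
      rw [← h]
      push_cast
      ring
    -- The sum of the four coefficients drops by `q + q'`, so this makes the induction strict.
    have hq : 0 < q + q' := by
      by_contra h0
      obtain ⟨rfl, rfl⟩ : q = 0 ∧ q' = 0 := by lia
      simp at h
    have hm : 0 < m + q := by
      by_contra h0
      obtain ⟨rfl, rfl⟩ : m = 0 ∧ q = 0 := by lia
      simp at h
    have hm' : 0 < m' + q' := by
      by_contra h0
      obtain ⟨rfl, rfl⟩ : m' = 0 ∧ q' = 0 := by lia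
      simp at h
    obtain ⟨k, hk⟩ := ih (m + q + m' + q') (by lia) h3 rfl
    rw [hG.right_natCast hm, hG.right_natCast hm']
    obtain ⟨k1, k2⟩ := Prod.ext_iff.1 hk
    simp only [Prod.fst_sub, Prod.snd_sub] at k1 k2
    refine ⟨k / 3, Prod.ext ?_ ?_⟩
    · simp only [Prod.fst_sub]
      push_cast
      linarith
    · simp only [Prod.snd_sub]
      linarith
  by_cases hL : p ≤ q ∧ p' ≤ q'
  · obtain ⟨h1, h2⟩ := hL
    obtain ⟨m, rfl⟩ := Nat.exists_eq_add_of_le h1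
    obtain ⟨m', rfl⟩ := Nat.exists_eq_add_of_le h2
    have h3 : ((p : ℤ) * m' - m * p') ^ 2 = 1 := by
      rw [← h]
      push_cast
      ring
    have hp : 0 < p + p' := by
      by_contra h0
      obtain ⟨rfl, rfl⟩ : p = 0 ∧ p' = 0 := by lia
      simp at h
    have hm : 0 < p + m := by
      by_contra h0
      obtain ⟨rfl, rfl⟩ : p = 0 ∧ m = 0 := by lia
      simp at h
    have hm' : 0 < p' + m' := by
      by_contra h0
      obtain ⟨rfl, rfl⟩ : p' = 0 ∧ m' = 0 := by lia
      simp at h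
    obtain ⟨k, hk⟩ := ih (p + m + p' + m') (by lia) h3 rfl
    rw [hG.left_natCast hm, hG.left_natCast hm']
    obtain ⟨k1, k2⟩ := Prod.ext_iff.1 hk
    simp only [Prod.fst_sub, Prod.snd_sub] at k1 k2
    refine ⟨k / 3, Prod.ext ?_ ?_⟩
    · simp only [Prod.fst_sub]
      linarith
    · simp only [Prod.snd_sub]
      push_cast
      linarith
  rcases lt_or_ge p q with h1 | h1
  · obtain ⟨rfl, rfl, rfl, rfl⟩ := eq_one_of_farey_apart h h1 (by lia)
    exact ⟨-1, by simp [hG.zero, hG.one]⟩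
  · obtain ⟨rfl, rfl, rfl, rfl⟩ := eq_one_of_farey_apart (p := p') (q := q') (p' := p) (q' := q)
      (by rw [← h]; ring) (by lia) (by lia)
    exact ⟨1, by simp [hG.zero, hG.one]⟩

/-! ### The parameter as a function of the angle -/

/-- The angle of the vector with spinor `s ψ₁ + (1 - s) ψ₂`, where `A = |ψ₁|²`, `d` is the scalar
product of `ψ₁` and `ψ₂`, `e` their determinant, and `α` the angle of the vector with spinor
`ψ₁`. -/
def angleOfParam (A d e α s : ℝ) : ℝ :=
  α + 2 * Real.arctan ((1 - s) * e / (s * A + (1 - s) * d))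

/-- The inverse of `angleOfParam`. -/
def paramOfAngle (A d e α t : ℝ) : ℝ :=
  1 - Real.tan ((t - α) / 2) * (d / e) * A /
    ((1 - Real.tan ((t - α) / 2) * (d / e)) * d + Real.tan ((t - α) / 2) * (d / e) * A)

section

variable {A d e α : ℝ}

lemma weighted_pos (hA : 0 < A) (hd : 0 < d) {s : ℝ} (hs : s ∈ Set.Icc (0 : ℝ) 1) :
    0 < s * A + (1 - s) * d := by
  obtain ⟨h0, h1⟩ := hs
  rcases h0.eq_or_lt with rfl | h0
  · simpa using hd
  · have : 0 ≤ (1 - s) * d := mul_nonneg (by linarith) hd.le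
    have := mul_pos h0 hA
    linarith

lemma continuousOn_angleOfParam (hA : 0 < A) (hd : 0 < d) :
    ContinuousOn (angleOfParam A d e α) (Set.Icc 0 1) := by
  unfold angleOfParam
  refine continuousOn_const.add (continuousOn_const.mul
    (Real.continuous_arctan.comp_continuousOn (ContinuousOn.div (by fun_prop) (by fun_prop) ?_)))
  exact fun s hs ↦ (weighted_pos hA hd hs).ne'

lemma angleOfParam_mem (hA : 0 < A) (hd : 0 < d) {s : ℝ} (hs : s ∈ Set.Icc (0 : ℝ) 1) :
    angleOfParam A d e α s ∈ Set.uIcc α (α + 2 * Real.arctan (e / d)) := by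
  have hw := weighted_pos hA hd hs
  have h1 : (1 - s) * e / (s * A + (1 - s) * d) ∈ Set.uIcc 0 (e / d) := by
    rw [← segment_eq_uIcc]
    refine ⟨s * A / (s * A + (1 - s) * d), (1 - s) * d / (s * A + (1 - s) * d),
      div_nonneg (mul_nonneg hs.1 hA.le) hw.le,
      div_nonneg (mul_nonneg (by linarith [hs.2]) hd.le) hw.le, ?_, ?_⟩
    · field_simp
    · simp only [smul_eq_mul]
      field_simp
      ring
  have hmono : Monotone fun x ↦ α + 2 * Real.arctan x := fun x y h ↦ by
    have := Real.arctan_strictMono.monotone h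
    dsimp only
    linarith
  simpa [angleOfParam] using hmono.mapsTo_uIcc h1

lemma half_angle_mem {t : ℝ} (ht : t ∈ Set.uIcc α (α + 2 * Real.arctan (e / d))) :
    (t - α) / 2 ∈ Set.uIcc 0 (Real.arctan (e / d)) ∧
      (t - α) / 2 ∈ Set.Ioo (-(Real.pi / 2)) (Real.pi / 2) := by
  have h1 := Real.arctan_lt_pi_div_two (e / d)
  have h2 := Real.neg_pi_div_two_lt_arctan (e / d)
  have h3 := Real.pi_pos
  rw [Set.mem_uIcc] at ht ⊢
  rcases ht with ht | ht
  · exact ⟨.inl ⟨by linarith, by linarith⟩, by linarith, by linarith⟩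
  · exact ⟨.inr ⟨by linarith, by linarith⟩, by linarith, by linarith⟩

/-- At parameter `s` this normalized tangent is `(1 - s) d / (s A + (1 - s) d)`, a convex weight,
from which `paramOfAngle` recovers `s`. The factor `d / e` also absorbs the sign of `e`. -/
lemma tan_half_angle_mem (hd : 0 < d) (he : e ≠ 0) {t : ℝ}
    (ht : t ∈ Set.uIcc α (α + 2 * Real.arctan (e / d))) :
    Real.tan ((t - α) / 2) * (d / e) ∈ Set.Icc (0 : ℝ) 1 := by
  obtain ⟨h1, h2⟩ := half_angle_mem ht
  have hsub : Set.uIcc 0 (Real.arctan (e / d)) ⊆ Set.Ioo (-(Real.pi / 2)) (Real.pi / 2) :=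
    Set.ordConnected_Ioo.uIcc_subset ⟨by linarith [Real.pi_pos], by linarith [Real.pi_pos]⟩
      ⟨Real.neg_pi_div_two_lt_arctan _, Real.arctan_lt_pi_div_two _⟩
  have h3 := (Real.strictMonoOn_tan.monotoneOn.mono hsub).mapsTo_uIcc h1
  rw [Real.tan_zero, Real.tan_arctan, ← segment_eq_uIcc] at h3
  obtain ⟨a, b, ha, hb, hab, h4⟩ := h3
  have h5 : Real.tan ((t - α) / 2) * (d / e) = b := by
    rw [← h4]
    simp only [smul_eq_mul]
    field_simp
    ring
  rw [h5]
  exact ⟨hb, by linarith⟩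

lemma continuousOn_paramOfAngle (hA : 0 < A) (hd : 0 < d) (he : e ≠ 0) :
    ContinuousOn (paramOfAngle A d e α) (Set.uIcc α (α + 2 * Real.arctan (e / d))) := by
  have htan : ContinuousOn (fun t ↦ Real.tan ((t - α) / 2))
      (Set.uIcc α (α + 2 * Real.arctan (e / d))) :=
    Real.continuousOn_tan_Ioo.comp (by fun_prop) fun t ht ↦ (half_angle_mem ht).2
  unfold paramOfAngle
  refine continuousOn_const.sub (ContinuousOn.div (by fun_prop) (by fun_prop) fun t ht ↦ ?_)
  have := weighted_pos hA hd (tan_half_angle_mem hd he ht)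
  linarith

lemma paramOfAngle_mem (hA : 0 < A) (hd : 0 < d) (he : e ≠ 0) {t : ℝ}
    (ht : t ∈ Set.uIcc α (α + 2 * Real.arctan (e / d))) :
    paramOfAngle A d e α t ∈ Set.Icc (0 : ℝ) 1 := by
  have h1 := tan_half_angle_mem hd he ht
  have h2 := weighted_pos hA hd h1
  unfold paramOfAngle
  generalize Real.tan ((t - α) / 2) * (d / e) = l at *
  have h3 : 0 ≤ (1 - l) * d := mul_nonneg (by linarith [h1.2]) hd.le
  have h4 : 0 ≤ l * A := mul_nonneg h1.1 hA.le
  have h5 : l * A / ((1 - l) * d + l * A) ≤ 1 := div_le_one_of_le₀ (by linarith) (by linarith)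
  have h6 : 0 ≤ l * A / ((1 - l) * d + l * A) := div_nonneg h4 (by linarith)
  exact ⟨by linarith, by linarith⟩

lemma angleOfParam_paramOfAngle (hA : 0 < A) (hd : 0 < d) (he : e ≠ 0) {t : ℝ}
    (ht : t ∈ Set.uIcc α (α + 2 * Real.arctan (e / d))) :
    angleOfParam A d e α (paramOfAngle A d e α t) = t := by
  have h1 := tan_half_angle_mem hd he ht
  have h2 := weighted_pos hA hd h1
  have h3 := (half_angle_mem ht).2
  have h4 : (1 - paramOfAngle A d e α t) * e / (paramOfAngle A d e α t * A +
      (1 - paramOfAngle A d e α t) * d) = Real.tan ((t - α) / 2) := by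
    have h5 : Real.tan ((t - α) / 2) = Real.tan ((t - α) / 2) * (d / e) * (e / d) := by
      field_simp
    rw [h5]
    unfold paramOfAngle
    generalize Real.tan ((t - α) / 2) * (d / e) = l at *
    have h6 : (1 - l) * d + l * A ≠ 0 := by linarith
    have h7 : 1 - l * A / ((1 - l) * d + l * A) = (1 - l) * d / ((1 - l) * d + l * A) := by
      field_simp
      ring
    have h8 : (1 - l) * d / ((1 - l) * d + l * A) * A +
        (1 - (1 - l) * d / ((1 - l) * d + l * A)) * d = A * d / ((1 - l) * d + l * A) := by
      field_simp
      ring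
    rw [h7, h8]
    field_simp
    ring
  rw [angleOfParam, h4, Real.arctan_tan h3.1 h3.2]
  ring

lemma paramOfAngle_angleOfParam (hA : 0 < A) (hd : 0 < d) (he : e ≠ 0) {s : ℝ}
    (hs : s ∈ Set.Icc (0 : ℝ) 1) :
    paramOfAngle A d e α (angleOfParam A d e α s) = s := by
  have hw := weighted_pos hA hd hs
  have h1 : (angleOfParam A d e α s - α) / 2 =
      Real.arctan ((1 - s) * e / (s * A + (1 - s) * d)) := by
    rw [angleOfParam]
    ring
  have h2 : (1 - s) * e / (s * A + (1 - s) * d) * (d / e) =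
      (1 - s) * d / (s * A + (1 - s) * d) := by
    field_simp
  have h3 : (1 - (1 - s) * d / (s * A + (1 - s) * d)) * d +
      (1 - s) * d / (s * A + (1 - s) * d) * A = A * d / (s * A + (1 - s) * d) := by
    field_simp
    ring
  rw [paramOfAngle, h1, Real.tan_arctan, h2, h3]
  field_simp
  ring

end

/-! ### Angles of the circles and pairs of spinors -/

/-- The identity `|ψ|² φ = (dot ψ φ + i det ψ φ) ψ` shows that `φ` is at angle `θ` from `ψ`, and
squaring doubles it. As `dot ψ φ > 0`, `2 θ` lies in `(-π, π)` and is the principal argument. -/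
lemma angle_spinorCircle {C₀ : PlaneCircle} (h₀ : 0 < C₀.radius) {ψ φ : ℂ}
    (hψ : 1 < Complex.normSq ψ) (hφ : 1 < Complex.normSq φ) (hdot : 0 < dot ψ φ) :
    angle C₀ (spinorCircle C₀ ψ) (spinorCircle C₀ φ) =
      Complex.arg (v C₀ (spinorCircle C₀ ψ)) + 2 * Real.arctan (det ψ φ / dot ψ φ) := by
  have p1 := spinorCircle_radius_pos h₀ hψ
  have p2 := spinorCircle_radius_pos h₀ hφ
  have hψ0 : ψ ≠ 0 := by
    rintro rfl
    simp at hψ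
    linarith
  rw [angle]
  congr 1
  set τ := det ψ φ / dot ψ φ with hτ
  set θ := Real.arctan τ with hθ
  have hcos : 0 < Real.cos θ := Real.cos_arctan_pos τ
  have hsin : Real.sin θ = τ * Real.cos θ := by
    rw [← Real.tan_mul_cos hcos.ne', hθ, Real.tan_arctan]
  set k : ℝ := (spinorCircle C₀ φ).radius / (spinorCircle C₀ ψ).radius *
    (dot ψ φ / (Complex.normSq ψ * Real.cos θ)) ^ 2 with hk
  have hk0 : 0 < k := by positivity
  have key : v C₀ (spinorCircle C₀ φ) / v C₀ (spinorCircle C₀ ψ) =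
      k * (Complex.cos (2 * θ : ℝ) + Complex.sin (2 * θ : ℝ) * Complex.I) := by
    have h1 : (Complex.normSq ψ : ℂ) * φ =
        ((dot ψ φ / Real.cos θ : ℝ) : ℂ) * (Real.cos θ + Real.sin θ * Complex.I) * ψ := by
      have h2 : ((dot ψ φ / Real.cos θ : ℝ) : ℂ) * (Real.cos θ + Real.sin θ * Complex.I) =
          dot ψ φ + det ψ φ * Complex.I := by
        have h3 : det ψ φ = τ * dot ψ φ := by rw [hτ]; field_simp
        rw [hsin, h3]
        have : (Real.cos θ : ℂ) ≠ 0 := by exact_mod_cast hcos.ne'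
        push_cast at this ⊢
        field_simp
      rw [h2]
      apply Complex.ext <;>
      · simp only [det, dot, Complex.normSq_apply, Complex.add_re, Complex.add_im, Complex.mul_re,
          Complex.mul_im, Complex.ofReal_re, Complex.ofReal_im, Complex.I_re, Complex.I_im]
        ring
    have h4 : (Complex.cos (2 * θ : ℝ) + Complex.sin (2 * θ : ℝ) * Complex.I) =
        (Real.cos θ + Real.sin θ * Complex.I) ^ 2 := by
      push_cast
      rw [Complex.cos_two_mul, Complex.sin_two_mul]
      linear_combination Complex.sin θ ^ 2 * Complex.I_sq.symm + Complex.cos_sq_add_sin_sq θ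
    have hn : (Complex.normSq ψ : ℂ) ≠ 0 := by
      exact_mod_cast (by linarith : Complex.normSq ψ ≠ 0)
    have h5 : φ = ((dot ψ φ / Real.cos θ : ℝ) : ℂ) * (Real.cos θ + Real.sin θ * Complex.I) * ψ /
        Complex.normSq ψ := by
      rw [← h1]
      field_simp
    rw [v_spinorCircle, v_spinorCircle, h4, hk]
    generalize (spinorCircle C₀ φ).radius = r at *
    generalize (spinorCircle C₀ ψ).radius = r' at *
    have c1 : (r' : ℂ) ≠ 0 := by exact_mod_cast p1.ne'
    generalize dot ψ φ = d at *
    rw [h5]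
    push_cast
    field_simp
  have hπ := Real.pi_pos
  have hb1 := Real.neg_pi_div_two_lt_arctan τ
  have hb2 := Real.arctan_lt_pi_div_two τ
  rw [key]
  exact Complex.arg_mul_cos_add_sin_mul_I hk0 ⟨by linarith, by linarith⟩

/-- The spinors of two circles that are tangent to each other and to `C₀`; the signs are chosen so
that the spinors enclose an acute angle. -/
structure IsSpinorPair (ψ φ : ℂ) : Prop where
  left : 1 < Complex.normSq ψ
  right : 1 < Complex.normSq φ
  det_sq : det ψ φ ^ 2 = 1
  dot_pos : 0 < dot ψ φ

/-- Replacing `φ` by `-φ` makes the scalar product positive; it cannot vanish, since then `det² =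
|ψ|² |φ|² > 1`. -/
lemma exists_isSpinorPair {C₀ C₁ C₂ : PlaneCircle} (hr₀ : 0 < C₀.radius) (hr₁ : 0 < C₁.radius)
    (hr₂ : 0 < C₂.radius) (h₀₁ : C₀.IsExtTangent C₁) (h₀₂ : C₀.IsExtTangent C₂)
    (h₁₂ : C₁.IsExtTangent C₂) :
    ∃ ψ φ, IsSpinorPair ψ φ ∧ C₁ = spinorCircle C₀ ψ ∧ C₂ = spinorCircle C₀ φ := by
  obtain ⟨ψ, hψ, rfl⟩ := exists_eq_spinorCircle hr₀ hr₁ h₀₁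
  obtain ⟨φ, hφ, rfl⟩ := exists_eq_spinorCircle hr₀ hr₂ h₀₂
  rw [spinorCircle_isExtTangent_iff hr₀ hψ hφ] at h₁₂
  have hd := dot_sq_add_det_sq ψ φ
  rcases lt_trichotomy 0 (dot ψ φ) with h | h | h
  · exact ⟨ψ, φ, ⟨hψ, hφ, h₁₂, h⟩, rfl, rfl⟩
  · rw [← h] at hd
    nlinarith
  · refine ⟨ψ, -φ, ⟨hψ, by rwa [Complex.normSq_neg], ?_, ?_⟩, rfl, (spinorCircle_neg _ _).symm⟩
    · rw [← h₁₂]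
      simp only [det, Complex.neg_re, Complex.neg_im]
      ring
    · simp only [dot, Complex.neg_re, Complex.neg_im] at h ⊢
      linarith

namespace IsSpinorPair

variable {ψ φ : ℂ}

lemma add_right (h : IsSpinorPair ψ φ) : IsSpinorPair ψ (ψ + φ) where
  left := h.left
  right := one_lt_normSq_add h.left h.right h.dot_pos
  det_sq := by
    rw [← h.det_sq]
    simp only [det, Complex.add_re, Complex.add_im]
    ring
  dot_pos := by
    have : dot ψ (ψ + φ) = Complex.normSq ψ + dot ψ φ := by
      simp only [dot, Complex.add_re, Complex.add_im, Complex.normSq_apply]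
      ring
    linarith [h.left, h.dot_pos]

lemma symm (h : IsSpinorPair ψ φ) : IsSpinorPair φ ψ where
  left := h.right
  right := h.left
  det_sq := by rw [det_comm_neg, neg_sq, h.det_sq]
  dot_pos := by rw [dot_comm]; exact h.dot_pos

lemma add_left (h : IsSpinorPair ψ φ) : IsSpinorPair (ψ + φ) φ := by
  rw [add_comm]
  exact h.symm.add_right.symm

lemma det_ne_zero (h : IsSpinorPair ψ φ) : det ψ φ ≠ 0 := fun h0 ↦ by
  have := h.det_sq
  simp [h0] at this

lemma one_lt_normSq (h : IsSpinorPair ψ φ) {p q : ℕ} (hpq : 0 < p + q) :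
    1 < Complex.normSq (p * ψ + q * φ) := by
  have e : Complex.normSq (p * ψ + q * φ) =
      p ^ 2 * Complex.normSq ψ + q ^ 2 * Complex.normSq φ + 2 * (p * q * dot ψ φ) := by
    simp only [Complex.normSq_apply, dot, Complex.add_re, Complex.add_im, Complex.mul_re,
      Complex.mul_im, Complex.natCast_re, Complex.natCast_im]
    ring
  rw [e]
  have h1 := h.left
  have h2 := h.right
  have h3 : 0 ≤ (p : ℝ) * q * dot ψ φ := mul_nonneg (by positivity) h.dot_pos.le
  rcases Nat.eq_zero_or_pos p with rfl | hp
  · have hq : (1 : ℝ) ≤ q := by exact_mod_cast (by lia : 1 ≤ q)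
    have : (1 : ℝ) ≤ (q : ℝ) ^ 2 := by nlinarith
    nlinarith
  · have hp : (1 : ℝ) ≤ p := by exact_mod_cast hp
    have : (1 : ℝ) ≤ (p : ℝ) ^ 2 := by nlinarith
    have : 0 ≤ (q : ℝ) ^ 2 * Complex.normSq φ := by positivity
    nlinarith

lemma det_natCast (p q p' q' : ℕ) :
    det (p * ψ + q * φ) (p' * ψ + q' * φ) = ((p * q' - q * p' : ℤ) : ℝ) * det ψ φ := by
  simp only [det, Complex.add_re, Complex.add_im, Complex.mul_re,
    Complex.mul_im, Complex.natCast_re, Complex.natCast_im]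
  push_cast
  ring

lemma dot_natCast (p q p' q' : ℕ) :
    dot (p * ψ + q * φ) (p' * ψ + q' * φ) = p * p' * Complex.normSq ψ +
      q * q' * Complex.normSq φ + (p * q' + q * p') * dot ψ φ := by
  simp only [dot, Complex.normSq_apply, Complex.add_re, Complex.add_im, Complex.mul_re,
    Complex.mul_im, Complex.natCast_re, Complex.natCast_im]
  ring

lemma pos_of_det {p q p' q' : ℕ} (h : ((p : ℤ) * q' - q * p') ^ 2 = 1) :
    0 < p + q ∧ 0 < p' + q' := by
  constructor
  · by_contra h0
    obtain ⟨rfl, rfl⟩ : p = 0 ∧ q = 0 := by lia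
    simp at h
  · by_contra h0
    obtain ⟨rfl, rfl⟩ : p' = 0 ∧ q' = 0 := by lia
    simp at h

lemma natCast (h : IsSpinorPair ψ φ) {p q p' q' : ℕ} (hd : ((p : ℤ) * q' - q * p') ^ 2 = 1) :
    IsSpinorPair (p * ψ + q * φ) (p' * ψ + q' * φ) where
  left := h.one_lt_normSq (pos_of_det hd).1
  right := h.one_lt_normSq (pos_of_det hd).2
  det_sq := by
    rw [det_natCast, mul_pow, h.det_sq, mul_one]
    exact_mod_cast hd
  dot_pos := by
    rw [dot_natCast]
    have h1 : 0 < p * q' + q * p' := by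
      by_contra h0
      have : p * q' = 0 ∧ q * p' = 0 := by lia
      zify at this
      simp [this] at hd
    have h2 : (0 : ℝ) < (p : ℝ) * q' + q * p' := by exact_mod_cast h1
    have h3 := mul_pos h2 h.dot_pos
    have h4 : (0 : ℝ) ≤ p * p' * Complex.normSq ψ :=
      mul_nonneg (by positivity) (Complex.normSq_nonneg _)
    have h5 : (0 : ℝ) ≤ q * q' * Complex.normSq φ :=
      mul_nonneg (by positivity) (Complex.normSq_nonneg _)
    linarith

end IsSpinorPair

/-- The square roots of `v = r ψ²` are `±√r ψ`. -/
lemma mem_sqrtLine_iff {C₀ : PlaneCircle} (h₀ : 0 < C₀.radius) {ψ : ℂ}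
    (hψ : 1 < Complex.normSq ψ) {z : ℂ} :
    z ∈ sqrtLine C₀ (spinorCircle C₀ ψ) ↔ ∃ t : ℝ, z = t * ψ := by
  have hr := spinorCircle_radius_pos h₀ hψ
  have hs : ((√(spinorCircle C₀ ψ).radius : ℝ) : ℂ) ^ 2 = (spinorCircle C₀ ψ).radius := by
    exact_mod_cast Real.sq_sqrt hr.le
  have hs0 : ((√(spinorCircle C₀ ψ).radius : ℝ) : ℂ) ≠ 0 := by
    exact_mod_cast (Real.sqrt_pos.2 hr).ne'
  constructor
  · rintro ⟨w, hw, t, rfl⟩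
    rw [v_spinorCircle, ← hs, ← mul_pow] at hw
    rcases sq_eq_sq_iff_eq_or_eq_neg.1 hw with rfl | rfl
    · exact ⟨t * √(spinorCircle C₀ ψ).radius, by push_cast; ring⟩
    · exact ⟨-(t * √(spinorCircle C₀ ψ).radius), by push_cast; ring⟩
  · rintro ⟨t, rfl⟩
    refine ⟨(√(spinorCircle C₀ ψ).radius : ℝ) * ψ, ?_, t / √(spinorCircle C₀ ψ).radius, ?_⟩
    · rw [v_spinorCircle, mul_pow, hs]
    · push_cast
      field_simp

/-! ### The family in coordinates, and existence -/

section

variable {C₀ : PlaneCircle} {ψ φ : ℂ}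

/-- Only `0 < p + q` is recorded: it already makes the norm exceed `1`, and the unit determinant of
tangent pairs supplies the arithmetic. -/
lemma Family.exists_natCast (h₀ : 0 < C₀.radius) (h : IsSpinorPair ψ φ) {C : PlaneCircle}
    (hC : Family C₀ (spinorCircle C₀ ψ) (spinorCircle C₀ φ) C) :
    ∃ p q : ℕ, 0 < p + q ∧ C = spinorCircle C₀ (p * ψ + q * φ) := by
  induction hC with
  | left => exact ⟨1, 0, by simp⟩
  | right => exact ⟨0, 1, by simp⟩
  | succ _ _ ht hS ih ih' =>
    obtain ⟨p, q, hpq, rfl⟩ := ih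
    obtain ⟨p', q', hpq', rfl⟩ := ih'
    rw [spinorCircle_isExtTangent_iff h₀ (h.one_lt_normSq hpq) (h.one_lt_normSq hpq'),
      IsSpinorPair.det_natCast, mul_pow, h.det_sq, mul_one] at ht
    have hp := h.natCast (p := p) (q := q) (p' := p') (q' := q') (by exact_mod_cast ht)
    rw [isSuccessor_iff h₀ hp.left hp.right hp.det_sq hp.dot_pos] at hS
    refine ⟨p + p', q + q', by lia, hS.trans ?_⟩
    congr 1
    push_cast
    ring

/-- The angle of the circle with spinor `s ψ + (1 - s) φ`. -/
def spinorAngle (C₀ : PlaneCircle) (ψ φ : ℂ) (s : ℝ) : ℝ :=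
  angleOfParam (Complex.normSq ψ) (dot ψ φ) (det ψ φ) (Complex.arg (v C₀ (spinorCircle C₀ ψ))) s

lemma angle_natCast (h₀ : 0 < C₀.radius) (h : IsSpinorPair ψ φ) {p q : ℕ} (hpq : 0 < p + q) :
    angle C₀ (spinorCircle C₀ ψ) (spinorCircle C₀ (p * ψ + q * φ)) =
      spinorAngle C₀ ψ φ ((p : ℝ) / (p + q)) := by
  have hn : 0 < Complex.normSq ψ := by linarith [h.left]
  have hpq' : (0 : ℝ) < p + q := by exact_mod_cast hpq
  have e1 : dot ψ (p * ψ + q * φ) = p * Complex.normSq ψ + q * dot ψ φ := by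
    have := IsSpinorPair.dot_natCast (ψ := ψ) (φ := φ) 1 0 p q
    simpa using this
  have e2 : det ψ (p * ψ + q * φ) = q * det ψ φ := by
    have := IsSpinorPair.det_natCast (ψ := ψ) (φ := φ) 1 0 p q
    simpa using this
  have hpos : 0 < p * Complex.normSq ψ + q * dot ψ φ := by
    have hd := h.dot_pos
    rcases Nat.eq_zero_or_pos p with rfl | hp
    · have hq : 0 < q := by lia
      simp only [Nat.cast_zero, zero_mul, zero_add]
      positivity
    · positivity
  rw [angle_spinorCircle h₀ h.left (h.one_lt_normSq hpq) (by rwa [e1]), e1, e2, spinorAngle,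
    angleOfParam]
  congr 3
  have e3 : 1 - (p : ℝ) / (p + q) = q / (p + q) := by
    field_simp
    ring
  rw [e3]
  field_simp

lemma angleInterval_spinorCircle (h₀ : 0 < C₀.radius) (h : IsSpinorPair ψ φ) :
    angleInterval C₀ (spinorCircle C₀ ψ) (spinorCircle C₀ φ) =
      Set.uIcc (Complex.arg (v C₀ (spinorCircle C₀ ψ)))
        (Complex.arg (v C₀ (spinorCircle C₀ ψ)) + 2 * Real.arctan (det ψ φ / dot ψ φ)) := by
  have h1 := angle_natCast h₀ h (p := 1) (q := 0) (by norm_num)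
  have h2 := angle_natCast h₀ h (p := 0) (q := 1) (by norm_num)
  simp only [spinorAngle, angleOfParam, Nat.cast_one, Nat.cast_zero, one_mul, zero_mul, add_zero,
    zero_add, sub_self, sub_zero, div_one, zero_div, Real.arctan_zero, mul_zero] at h1 h2
  rw [angleInterval, h1, h2]

lemma natCast_div_mem (p q : ℕ) : (p : ℝ) / (p + q) ∈ Set.Icc (0 : ℝ) 1 :=
  ⟨by positivity, div_le_one_of_le₀ (by linarith [q.cast_nonneg (α := ℝ)]) (by positivity)⟩

lemma spinorAngle_mem (h₀ : 0 < C₀.radius) (h : IsSpinorPair ψ φ) {s : ℝ}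
    (hs : s ∈ Set.Icc (0 : ℝ) 1) :
    spinorAngle C₀ ψ φ s ∈ angleInterval C₀ (spinorCircle C₀ ψ) (spinorCircle C₀ φ) := by
  rw [angleInterval_spinorCircle h₀ h]
  exact angleOfParam_mem (by linarith [h.left]) h.dot_pos hs

lemma exists_apollonianCurve (h₀ : 0 < C₀.radius) (h : IsSpinorPair ψ φ) :
    ∃ γ : ℝ → ℂ, IsApollonianCurve C₀ (spinorCircle C₀ ψ) (spinorCircle C₀ φ) γ ∧
      Nonconstant C₀ (spinorCircle C₀ ψ) (spinorCircle C₀ φ) γ := by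
  obtain ⟨G, hG⟩ := exists_fareyCurve
  have hA : 0 < Complex.normSq ψ := by linarith [h.left]
  let α := Complex.arg (v C₀ (spinorCircle C₀ ψ))
  let σ : ℝ → ℝ := paramOfAngle (Complex.normSq ψ) (dot ψ φ) (det ψ φ) α
  have hσ (s : ℝ) (hs : s ∈ Set.Icc (0 : ℝ) 1) : σ (spinorAngle C₀ ψ φ s) = s :=
    paramOfAngle_angleOfParam hA h.dot_pos h.det_ne_zero hs
  refine ⟨fun t ↦ ((G (σ t)).1 : ℂ) * ψ + ((G (σ t)).2 : ℂ) * φ, ⟨?_, ?_⟩, ?_⟩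
  · have hc : ContinuousOn (fun t ↦ G (σ t))
        (angleInterval C₀ (spinorCircle C₀ ψ) (spinorCircle C₀ φ)) := by
      rw [angleInterval_spinorCircle h₀ h]
      exact hG.continuous.comp_continuousOn
        (continuousOn_paramOfAngle hA h.dot_pos h.det_ne_zero)
    exact ((Complex.continuous_ofReal.comp_continuousOn hc.fst).mul continuousOn_const).add
      ((Complex.continuous_ofReal.comp_continuousOn hc.snd).mul continuousOn_const)
  · intro C C' hC hC' ht
    obtain ⟨p, q, hpq, rfl⟩ := hC.exists_natCast h₀ h
    obtain ⟨p', q', hpq', rfl⟩ := hC'.exists_natCast h₀ h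
    rw [spinorCircle_isExtTangent_iff h₀ (h.one_lt_normSq hpq) (h.one_lt_normSq hpq'),
      IsSpinorPair.det_natCast, mul_pow, h.det_sq, mul_one] at ht
    have hd : ((p : ℤ) * q' - q * p') ^ 2 = 1 := by exact_mod_cast ht
    have hp := h.natCast hd
    rw [angle_natCast h₀ h hpq, angle_natCast h₀ h hpq']
    refine ⟨spinorAngle_mem h₀ h (natCast_div_mem p q), spinorAngle_mem h₀ h (natCast_div_mem p' q'),
      _, isSuccessor_spinorCircle_add h₀ hp.left hp.right hp.det_sq hp.dot_pos, ?_⟩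
    rw [mem_sqrtLine_iff h₀ (one_lt_normSq_add hp.left hp.right hp.dot_pos)]
    obtain ⟨k, hk⟩ := hG.chord hd
    refine ⟨k, ?_⟩
    rw [hσ _ (natCast_div_mem p q), hσ _ (natCast_div_mem p' q')]
    obtain ⟨k1, k2⟩ := Prod.ext_iff.1 hk
    simp only [Prod.fst_sub, Prod.snd_sub] at k1 k2
    have k1' := congrArg Complex.ofReal k1
    have k2' := congrArg Complex.ofReal k2
    push_cast at k1' k2'
    linear_combination ψ * k1' + φ * k2'
  · refine ⟨_, spinorAngle_mem h₀ h ⟨le_rfl, zero_le_one⟩, _,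
      spinorAngle_mem h₀ h ⟨zero_le_one, le_rfl⟩, ?_⟩
    dsimp only
    rw [hσ 0 (by simp), hσ 1 (by simp), hG.zero, hG.one]
    simp only [Complex.ofReal_zero, Complex.ofReal_one, zero_mul, one_mul, add_zero]
    intro h0
    have := one_lt_normSq_add h.left h.right h.dot_pos
    rw [← h0, map_zero] at this
    linarith

/-! ### Uniqueness -/

lemma eq_of_chord_add {a b z w : ℂ} (hdet : det a b ≠ 0) (s t : ℝ) (h : z - w = s * a)
    (h' : z - w = t * b) : z = w := by
  have h1 : s * det a b = 0 := by
    have e : det (s * a) b = s * det a b := by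
      simp only [det, Complex.re_ofReal_mul, Complex.im_ofReal_mul]
      ring
    rw [← e, ← h, h']
    simp only [det, Complex.re_ofReal_mul, Complex.im_ofReal_mul]
    ring
  have h2 : s = 0 := (mul_eq_zero.1 h1).resolve_right hdet
  rw [h2, Complex.ofReal_zero, zero_mul] at h
  exact sub_eq_zero.1 h

lemma IsApollonianCurve.exists_chord (h₀ : 0 < C₀.radius) {C₁ C₂ : PlaneCircle} {γ : ℝ → ℂ}
    (hγ : IsApollonianCurve C₀ C₁ C₂ γ) {a b : ℂ} (hab : IsSpinorPair a b)
    (ha : Family C₀ C₁ C₂ (spinorCircle C₀ a)) (hb : Family C₀ C₁ C₂ (spinorCircle C₀ b)) :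
    ∃ t : ℝ, γ (angle C₀ C₁ (spinorCircle C₀ a)) - γ (angle C₀ C₁ (spinorCircle C₀ b)) =
      t * (a + b) := by
  obtain ⟨-, -, S, hS, hmem⟩ := hγ.chord _ _ ha hb
    ((spinorCircle_isExtTangent_iff h₀ hab.left hab.right).2 hab.det_sq)
  rw [isSuccessor_iff h₀ hab.left hab.right hab.det_sq hab.dot_pos] at hS
  rw [hS, mem_sqrtLine_iff h₀ (one_lt_normSq_add hab.left hab.right hab.dot_pos)] at hmem
  exact hmem

lemma Family.spinorCircle_add (h₀ : 0 < C₀.radius) {C₁ C₂ : PlaneCircle} {a b : ℂ}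
    (hab : IsSpinorPair a b) (ha : Family C₀ C₁ C₂ (spinorCircle C₀ a))
    (hb : Family C₀ C₁ C₂ (spinorCircle C₀ b)) : Family C₀ C₁ C₂ (spinorCircle C₀ (a + b)) :=
  .succ ha hb ((spinorCircle_isExtTangent_iff h₀ hab.left hab.right).2 hab.det_sq)
    (isSuccessor_spinorCircle_add h₀ hab.left hab.right hab.det_sq hab.dot_pos)

/-- The value at the successor differs from `c` by multiples of both `2 a + b` and `a + 2 b`. These
are independent, with determinant `3 det a b`, so the value is `c`; subtractive Euclid on `(p, q)`
propagates it. -/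
lemma IsApollonianCurve.eq_on_family (h₀ : 0 < C₀.radius) {C₁ C₂ : PlaneCircle} {γ : ℝ → ℂ}
    (hγ : IsApollonianCurve C₀ C₁ C₂ γ) {c : ℂ} {p q : ℕ} (hpq : p.Coprime q) {a b : ℂ}
    (hab : IsSpinorPair a b) (ha : Family C₀ C₁ C₂ (spinorCircle C₀ a))
    (hb : Family C₀ C₁ C₂ (spinorCircle C₀ b)) (hca : γ (angle C₀ C₁ (spinorCircle C₀ a)) = c)
    (hcb : γ (angle C₀ C₁ (spinorCircle C₀ b)) = c) :
    γ (angle C₀ C₁ (spinorCircle C₀ (p * a + q * b))) = c := by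
  induction hn : p + q using Nat.strong_induction_on generalizing p q a b with
  | _ n ih =>
  subst hn
  have hs := ha.spinorCircle_add h₀ hab hb
  have hcs : γ (angle C₀ C₁ (spinorCircle C₀ (a + b))) = c := by
    obtain ⟨s, h1⟩ := hγ.exists_chord h₀ hab.add_right ha hs
    obtain ⟨t, h2⟩ := hγ.exists_chord h₀ hab.add_left hs hb
    rw [hca] at h1
    rw [hcb] at h2
    refine eq_of_chord_add (a := a + (a + b)) (b := a + b + b) ?_ (-s) t ?_ h2
    · have e : det (a + (a + b)) (a + b + b) = 3 * det a b := by
        simp only [det, Complex.add_re, Complex.add_im]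
        ring
      rw [e]
      exact mul_ne_zero (by norm_num) hab.det_ne_zero
    · push_cast
      linear_combination -h1
  rcases Nat.eq_zero_or_pos p with rfl | hp
  · rw [Nat.coprime_zero_left] at hpq
    subst hpq
    simpa using hcb
  rcases Nat.eq_zero_or_pos q with rfl | hq
  · rw [Nat.coprime_zero_right] at hpq
    subst hpq
    simpa using hca
  -- For `q = p + m` one has `p a + q b = p (a + b) + m b`, and symmetrically in the other case.
  rcases le_total p q with hle | hle
  · obtain ⟨m, rfl⟩ := Nat.exists_eq_add_of_le hle
    have := ih (p + m) (by lia) (p := p) (q := m) (by simpa using hpq) hab.add_left hs hb hcs hcb rfl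
    rw [← this]
    congr 3
    push_cast
    ring
  · obtain ⟨m, rfl⟩ := Nat.exists_eq_add_of_le hle
    have := ih (m + q) (by lia) (p := m) (q := q) (by simpa using hpq) hab.add_right ha hs hca hcs rfl
    rw [← this]
    congr 3
    push_cast
    ring

lemma IsApollonianCurve.const_of_eq (h₀ : 0 < C₀.radius) (h : IsSpinorPair ψ φ) {γ : ℝ → ℂ}
    (hγ : IsApollonianCurve C₀ (spinorCircle C₀ ψ) (spinorCircle C₀ φ) γ)
    (heq : γ (spinorAngle C₀ ψ φ 1) = γ (spinorAngle C₀ ψ φ 0)) {t : ℝ}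
    (ht : t ∈ angleInterval C₀ (spinorCircle C₀ ψ) (spinorCircle C₀ φ)) :
    γ t = γ (spinorAngle C₀ ψ φ 0) := by
  have hA : 0 < Complex.normSq ψ := by linarith [h.left]
  set c := γ (spinorAngle C₀ ψ φ 0) with hc
  have hcont : ContinuousOn (fun s ↦ γ (spinorAngle C₀ ψ φ s)) (Set.Icc 0 1) :=
    hγ.continuousOn.comp (continuousOn_angleOfParam hA h.dot_pos)
      fun s hs ↦ spinorAngle_mem h₀ h hs
  have h1 := angle_natCast h₀ h (p := 1) (q := 0) (by norm_num)
  have h2 := angle_natCast h₀ h (p := 0) (q := 1) (by norm_num)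
  simp only [Nat.cast_one, Nat.cast_zero, one_mul, zero_mul, add_zero, zero_add, div_one]
    at h1 h2
  have hrat (x : ℚ) (hx : (x : ℝ) ∈ Set.Icc (0 : ℝ) 1) : γ (spinorAngle C₀ ψ φ x) = c := by
    have hx0 : 0 ≤ x := by exact_mod_cast hx.1
    have hx1 : x ≤ 1 := by exact_mod_cast hx.2
    obtain ⟨p, hp⟩ := Int.eq_ofNat_of_zero_le (Rat.num_nonneg.2 hx0)
    have hle : p ≤ x.den := by
      have h3 := Rat.num_le_denom_iff.2 hx1
      lia
    -- With `q` the denominator minus the numerator, `x = p / (p + q)` is the parameter of `p ψ + q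
    -- φ`.
    obtain ⟨q, hq⟩ := Nat.exists_eq_add_of_le hle
    have hcop : p.Coprime q := by
      have := x.reduced
      rw [hp, hq] at this
      simpa using this
    have hpos : 0 < p + q := hq ▸ x.pos
    have hxe : (x : ℝ) = (p : ℝ) / (p + q) := by
      rw [Rat.cast_def, hp, hq]
      push_cast
      rfl
    rw [hxe, ← angle_natCast h₀ h hpos]
    exact hγ.eq_on_family h₀ hcop h .left .right (by rw [h1, heq]) (by rw [h2])
  have hall : Set.EqOn (fun s ↦ γ (spinorAngle C₀ ψ φ s)) (fun _ ↦ c) (Set.Icc 0 1) := by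
    refine Set.EqOn.of_subset_closure (s := Set.Ioo 0 1 ∩ Set.range ((↑) : ℚ → ℝ)) ?_ hcont
      continuousOn_const (Set.inter_subset_left.trans Set.Ioo_subset_Icc_self) ?_
    · rintro _ ⟨hx, x, rfl⟩
      exact hrat x (Set.Ioo_subset_Icc_self hx)
    · rw [← closure_Ioo zero_ne_one]
      exact closure_minimal ((Rat.isDenseEmbedding_coe_real.dense).open_subset_closure_inter
        isOpen_Ioo) isClosed_closure
  rw [angleInterval_spinorCircle h₀ h] at ht
  have h3 := hall (paramOfAngle_mem hA h.dot_pos h.det_ne_zero ht)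
  simp only [spinorAngle] at h3
  rwa [angleOfParam_paramOfAngle hA h.dot_pos h.det_ne_zero ht] at h3

/-- Uniqueness of the successor puts the chords of both curves on the same line through the origin.
-/
lemma IsApollonianCurve.sub_real_mul (h₀ : 0 < C₀.radius) (h : IsSpinorPair ψ φ) {γ γ' : ℝ → ℂ}
    (hγ : IsApollonianCurve C₀ (spinorCircle C₀ ψ) (spinorCircle C₀ φ) γ)
    (hγ' : IsApollonianCurve C₀ (spinorCircle C₀ ψ) (spinorCircle C₀ φ) γ') (a : ℝ) :
    IsApollonianCurve C₀ (spinorCircle C₀ ψ) (spinorCircle C₀ φ) (fun t ↦ γ' t - a * γ t) where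
  continuousOn := hγ'.continuousOn.sub (continuousOn_const.mul hγ.continuousOn)
  chord C C' hC hC' ht := by
    have hm := hγ.chord C C' hC hC' ht
    refine ⟨hm.1, hm.2.1, ?_⟩
    obtain ⟨p, q, hpq, rfl⟩ := hC.exists_natCast h₀ h
    obtain ⟨p', q', hpq', rfl⟩ := hC'.exists_natCast h₀ h
    rw [spinorCircle_isExtTangent_iff h₀ (h.one_lt_normSq hpq) (h.one_lt_normSq hpq'),
      IsSpinorPair.det_natCast, mul_pow, h.det_sq, mul_one] at ht
    have hd : ((p : ℤ) * q' - q * p') ^ 2 = 1 := by exact_mod_cast ht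
    have hp := h.natCast hd
    refine ⟨_, isSuccessor_spinorCircle_add h₀ hp.left hp.right hp.det_sq hp.dot_pos, ?_⟩
    rw [mem_sqrtLine_iff h₀ (one_lt_normSq_add hp.left hp.right hp.dot_pos)]
    obtain ⟨s, hs⟩ := hγ.exists_chord h₀ hp hC hC'
    obtain ⟨t, ht⟩ := hγ'.exists_chord h₀ hp hC hC'
    refine ⟨t - a * s, ?_⟩
    push_cast
    linear_combination ht - a * hs

lemma IsApollonianCurve.exists_eq_real_mul_add (h₀ : 0 < C₀.radius) (h : IsSpinorPair ψ φ)
    {γ γ' : ℝ → ℂ} (hγ : IsApollonianCurve C₀ (spinorCircle C₀ ψ) (spinorCircle C₀ φ) γ)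
    (hnc : Nonconstant C₀ (spinorCircle C₀ ψ) (spinorCircle C₀ φ) γ)
    (hγ' : IsApollonianCurve C₀ (spinorCircle C₀ ψ) (spinorCircle C₀ φ) γ') :
    ∃ (a : ℝ) (b : ℂ), ∀ t ∈ angleInterval C₀ (spinorCircle C₀ ψ) (spinorCircle C₀ φ),
      γ' t = a * γ t + b := by
  have h1 := angle_natCast h₀ h (p := 1) (q := 0) (by norm_num)
  have h2 := angle_natCast h₀ h (p := 0) (q := 1) (by norm_num)
  simp only [Nat.cast_one, Nat.cast_zero, one_mul, zero_mul, add_zero, zero_add, div_one]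
    at h1 h2
  obtain ⟨s, hs⟩ := hγ.exists_chord h₀ h .left .right
  obtain ⟨s', hs'⟩ := hγ'.exists_chord h₀ h .left .right
  rw [h1, h2] at hs hs'
  have hs0 : s ≠ 0 := by
    rintro rfl
    rw [Complex.ofReal_zero, zero_mul, sub_eq_zero] at hs
    obtain ⟨x, hx, y, hy, hxy⟩ := hnc
    exact hxy ((hγ.const_of_eq h₀ h hs hx).trans (hγ.const_of_eq h₀ h hs hy).symm)
  have hs0' : (s : ℂ) ≠ 0 := by exact_mod_cast hs0
  -- The end chords are `s (ψ + φ)` and `s' (ψ + φ)`, so the factor `s' / s` gives `γ' - a γ` equal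
  -- end values.
  have hδ := hγ.sub_real_mul h₀ h hγ' (s' / s)
  refine ⟨s' / s, γ' (spinorAngle C₀ ψ φ 0) - (s' / s : ℝ) * γ (spinorAngle C₀ ψ φ 0),
    fun t ht ↦ ?_⟩
  have := hδ.const_of_eq h₀ h (by
    push_cast
    have e : (s' : ℂ) / s * s = s' := by field_simp
    linear_combination hs' - s' / s * hs - (ψ + φ) * e) ht
  linear_combination this

end

end Apollonian

end

theorem theorem5p2 (C₀ C₁ C₂ : Apollonian.PlaneCircle)
    (hr₀ : 0 < C₀.radius) (hr₁ : 0 < C₁.radius) (hr₂ : 0 < C₂.radius)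
    (h₀₁ : C₀.IsExtTangent C₁) (h₀₂ : C₀.IsExtTangent C₂) (h₁₂ : C₁.IsExtTangent C₂) :
    (∃ γ : ℝ → ℂ, Apollonian.IsApollonianCurve C₀ C₁ C₂ γ ∧
      Apollonian.Nonconstant C₀ C₁ C₂ γ) ∧
    (∀ γ γ' : ℝ → ℂ, Apollonian.IsApollonianCurve C₀ C₁ C₂ γ →
      Apollonian.Nonconstant C₀ C₁ C₂ γ → Apollonian.IsApollonianCurve C₀ C₁ C₂ γ' →
      ∃ (a : ℝ) (b : ℂ), ∀ t ∈ Apollonian.angleInterval C₀ C₁ C₂, γ' t = a * γ t + b) := by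
  obtain ⟨ψ, φ, h, rfl, rfl⟩ :=
    Apollonian.exists_isSpinorPair hr₀ hr₁ hr₂ h₀₁ h₀₂ h₁₂
  exact ⟨Apollonian.exists_apollonianCurve hr₀ h,
    fun γ γ' hγ hnc hγ' ↦ hγ.exists_eq_real_mul_add hr₀ h hnc hγ'⟩
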